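/- Let $K\ge 1$, $N\ge 2K$ and $K\le L\le N-K$ be integers. Let $z_1,\dots,z_K\in\mathbb C$ be pairwise distinct and non-zero with $|z_k|\le 1$, let $\alpha_1,\dots,\alpha_K\in\mathbb C\setminus\{0\}$, let $e=(e_0,\dots,e_{N-1})\in\mathbb C^N$, and put $\tilde x_n=\sum_{k=1}^K\alpha_k z_k^n+e_n$ for $0\le n\le N-1$. Let $V_M=(z_k^{\,i})_{0\le i\le M-1,\,1\le k\le K}$ be the $M\times K$ Vandermonde matrix, let $\sigma_{\min},\sigma_{\max}$ denote the smallest and largest singular value, $\kappa=\sigma_{\max}/\sigma_{\min}$, $\alpha_{\min}=\min_k|\alpha_k|$, $\alpha_{\max}=\max_k|\alpha_k|$ and $A_{\min}=\min_k|z_k|$. The matrix pencil method works as follows. Let $\tilde X_1=(\tilde x_{i+j})$ and $\tilde X_2=(\tilde x_{i+j+1})$, $0\le i\le L-1$, $0\le j\le N-L-1$, be $L\times(N-L)$ Hankel matrices. Take a singular value decomposition of $\tilde X_1$ and let the columns of $\tilde S_1\in\mathbb C^{L\times K}$ and $\tilde R_1\in\mathbb C^{(N-L)\times K}$ be the left and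 right singular vectors belonging to the $K$ largest singular values. Put $\tilde\Psi_i=\tilde S_1^H\tilde X_i\tilde R_1\in\mathbb C^{K\times K}$, $i=1,2$. The estimates $\hat z_1,\dots,\hat z_K\in\mathbb C\cup\{\infty\}$ are the generalized eigenvalues of the pair $(\tilde\Psi_1,\tilde\Psi_2)$ counted with algebraic multiplicity: the roots of $\det(\tilde\Psi_2-\lambda\tilde\Psi_1)$ with multiplicity, and $\infty$ for each of the roots missing to make $K$. Assume that $(\tilde\Psi_1,\tilde\Psi_2)$ is regular, i.e. $\det(a\tilde\Psi_1-b\tilde\Psi_2)\ne0$ for some $a,b\in\mathbb C$, that $$\gamma:=\frac{\sqrt{\min\{L,N-L\}}\,\|e\|_2}{\alpha_{\min}\,\sigma_{\min}(V_L)\,\sigma_{\min}(V_{N-L})}<1,$$ and that $$d:=\frac{(2K-1)\gamma}{\sqrt{1+A_{\min}^2}}\left[\frac{2\sqrt2}{1-\gamma}\,\frac{\alpha_{\max}}{\alpha_{\min}}\,\kappa(V_L)\,\kappa(V_{N-L})+\left(1+\frac{\sqrt2\,\gamma}{1-\gamma}\right)\right]<\frac1{\sqrt2}.$$ Then there is a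 permutation $\pi$ of $\{1,\dots,K\}$ such that for all $k=1,\dots,K$ the estimate $\hat z_{\pi(k)}$ is finite and $$|z_k-\hat z_{\pi(k)}|\le\eta_k:=\frac{d\sqrt{1-d^2}\,(1+|z_k|^2)}{1-d^2(1+|z_k|^2)}+\left(1-\frac1{1-d^2(1+|z_k|^2)}\right)|z_k| .$$ In particular, none of the estimates is $\infty$. -/

import Mathlib

open scoped Matrix

noncomputable section

namespace CisoidMP

/-- The smallest singular value of an `m × n` matrix: the last of its `min m n` singular values
(Mathlib lists singular values in decreasing order, starting from index `0`). -/
def sigmaMin {m n : ℕ} (A : Matrix (Fin m) (Fin n) ℂ) : ℝ :=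
  (Matrix.toEuclideanLin A).singularValues (min m n - 1)

/-- The largest singular value of a matrix. -/
def sigmaMax {m n : ℕ} (A : Matrix (Fin m) (Fin n) ℂ) : ℝ :=
  (Matrix.toEuclideanLin A).singularValues 0

/-- The condition number of a matrix. -/
def condNumber {m n : ℕ} (A : Matrix (Fin m) (Fin n) ℂ) : ℝ :=
  sigmaMax A / sigmaMin A

/-- The `L × K` Vandermonde matrix with nodes `z`: row `i`, column `k` holds `z k ^ i`. -/
def vanderMat {K : ℕ} (L : ℕ) (z : Fin K → ℂ) : Matrix (Fin L) (Fin K) ℂ :=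
  Matrix.of fun i k => z k ^ (i : ℕ)

/-- The `L × M` Hankel matrix of the `n = L + M - 1` numbers `x 0, …, x (n - 1)`. -/
def hankel {n : ℕ} (L M : ℕ) (h : L + M = n + 1) (x : Fin n → ℂ) :
    Matrix (Fin L) (Fin M) ℂ :=
  Matrix.of fun i j => x ⟨(i : ℕ) + (j : ℕ), by omega⟩

/-- The `L × (N - L)` Hankel matrix of `x 0, …, x (N - 2)`. -/
def dataMat₁ {N : ℕ} (L : ℕ) (h : L < N) (x : Fin N → ℂ) :
    Matrix (Fin L) (Fin (N - L)) ℂ :=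
  hankel (n := N - 1) L (N - L) (by omega) fun i => x ⟨(i : ℕ), by omega⟩

/-- The `L × (N - L)` Hankel matrix of `x 1, …, x (N - 1)`. -/
def dataMat₂ {N : ℕ} (L : ℕ) (h : L < N) (x : Fin N → ℂ) :
    Matrix (Fin L) (Fin (N - L)) ℂ :=
  hankel (n := N - 1) L (N - L) (by omega) fun i => x ⟨(i : ℕ) + 1, by omega⟩

/-- The noiseless samples `x n = ∑ k, α k * z k ^ n`, `n = 0, …, N - 1`. -/
def cisoidSum {K : ℕ} (N : ℕ) (α z : Fin K → ℂ) : Fin N → ℂ :=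
  fun n => ∑ k, α k * z k ^ (n : ℕ)

/-- The rectangular diagonal `m × n` matrix with diagonal entries `s`. -/
def rectDiag {m n : ℕ} (s : Fin (min m n) → ℝ) : Matrix (Fin m) (Fin n) ℂ :=
  Matrix.of fun i j =>
    if h : (i : ℕ) = (j : ℕ) then ((s ⟨(i : ℕ), by omega⟩ : ℝ) : ℂ) else 0

/-- A singular value decomposition `A = U Σ Wᴴ` in which the first `K` diagonal entries of `Σ` are
the `K` largest singular values of `A` (the order within the two groups is free). -/
structure SVD {m n : ℕ} (A : Matrix (Fin m) (Fin n) ℂ) (K : ℕ) where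
  U : Matrix (Fin m) (Fin m) ℂ
  W : Matrix (Fin n) (Fin n) ℂ
  s : Fin (min m n) → ℝ
  U_unitary : U ∈ Matrix.unitaryGroup (Fin m) ℂ
  W_unitary : W ∈ Matrix.unitaryGroup (Fin n) ℂ
  s_nonneg : ∀ i, 0 ≤ s i
  s_le : ∀ i j : Fin (min m n), (i : ℕ) < K → K ≤ (j : ℕ) → s j ≤ s i
  eq_mul : A = U * rectDiag s * Wᴴ

/-- The first `K` left singular vectors, as the columns of an `m × K` matrix. -/
def SVD.left {m n K : ℕ} {A : Matrix (Fin m) (Fin n) ℂ} (D : SVD A K) (hK : K ≤ m) :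
    Matrix (Fin m) (Fin K) ℂ :=
  D.U.submatrix id (Fin.castLE hK)

/-- The first `K` right singular vectors, as the columns of an `n × K` matrix. -/
def SVD.right {m n K : ℕ} {A : Matrix (Fin m) (Fin n) ℂ} (D : SVD A K) (hK : K ≤ n) :
    Matrix (Fin n) (Fin K) ℂ :=
  D.W.submatrix id (Fin.castLE hK)

/-- The compression `Sᴴ B R` of a matrix `B` to the first `K` left and right singular vectors of a
singular value decomposition of `A`. -/
def SVD.compress {m n K : ℕ} {A : Matrix (Fin m) (Fin n) ℂ} (D : SVD A K) (hm : K ≤ m)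
    (hn : K ≤ n) (B : Matrix (Fin m) (Fin n) ℂ) : Matrix (Fin K) (Fin K) ℂ :=
  (D.left hm)ᴴ * B * D.right hn

/-- The pair `(A, B)` is regular. -/
def IsRegularPair {K : ℕ} (A B : Matrix (Fin K) (Fin K) ℂ) : Prop :=
  ∃ a b : ℂ, (a • A - b • B).det ≠ 0

/-- The polynomial `λ ↦ det (B - λ A)`. -/
def pencilPoly {K : ℕ} (A B : Matrix (Fin K) (Fin K) ℂ) : Polynomial ℂ :=
  (B.map Polynomial.C - (Polynomial.X : Polynomial ℂ) • A.map Polynomial.C).det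

/-- The `K` generalized eigenvalues in `ℂ ∪ {∞}` of a regular pair `(A, B)` of `K × K` matrices
(the `λ` with `B y = λ A y` for some `y ≠ 0`), counted with algebraic multiplicity: the roots of
`det (B - λ A)`, the missing ones being equal to `∞`. -/
def genEigenvalues {K : ℕ} (A B : Matrix (Fin K) (Fin K) ℂ) : Multiset (OnePoint ℂ) :=
  (pencilPoly A B).roots.map (fun w => (w : OnePoint ℂ)) +
    Multiset.replicate (K - (pencilPoly A B).natDegree) OnePoint.infty

/-- `zhat` lists the estimates delivered by the matrix pencil method from the samples `x`, when the
singular value decomposition `D` of the first data matrix is used. -/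
def IsMPEstimate {N K L : ℕ} (hL : L < N) (hKL : K ≤ L) (hKN : K ≤ N - L) (x : Fin N → ℂ)
    (D : SVD (dataMat₁ L hL x) K) (zhat : Fin K → OnePoint ℂ) : Prop :=
  Finset.univ.val.map zhat =
    genEigenvalues (D.compress hKL hKN (dataMat₁ L hL x))
      (D.compress hKL hKN (dataMat₂ L hL x))

/-- The noise-to-signal quantity `γ` of the matrix pencil method. -/
def mpGamma {N K : ℕ} (L : ℕ) (z α : Fin K → ℂ) (e : EuclideanSpace ℂ (Fin N)) : ℝ :=
  Real.sqrt ((min L (N - L) : ℕ) : ℝ) * ‖e‖ /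
    ((⨅ k, ‖α k‖) * sigmaMin (vanderMat L z) * sigmaMin (vanderMat (N - L) z))

/-- The bound `d` on the chordal errors. -/
def mpChordalBound {N K : ℕ} (L : ℕ) (z α : Fin K → ℂ) (e : EuclideanSpace ℂ (Fin N)) : ℝ :=
  (2 * (K : ℝ) - 1) * mpGamma L z α e / Real.sqrt (1 + (⨅ k, ‖z k‖) ^ 2) *
    (2 * Real.sqrt 2 / (1 - mpGamma L z α e) * ((⨆ k, ‖α k‖) / (⨅ k, ‖α k‖)) *
        condNumber (vanderMat L z) * condNumber (vanderMat (N - L) z) +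
      (1 + Real.sqrt 2 * mpGamma L z α e / (1 - mpGamma L z α e)))

/-- The Euclidean error bound `η` for a node of modulus `r`, in terms of the chordal bound `d`. -/
def mpEta (d r : ℝ) : ℝ :=
  d * Real.sqrt (1 - d ^ 2) * (1 + r ^ 2) / (1 - d ^ 2 * (1 + r ^ 2)) +
    (1 - 1 / (1 - d ^ 2 * (1 + r ^ 2))) * r

end CisoidMP

end

noncomputable section

namespace CisoidMP

/-! Write B for the Vandermonde matrix of height L and F for the transpose of the one of height N-L.
The data matrices are B diag(α) F + E₁ and B diag(α z) F + E₂, where the Hankel noise blocks have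
norm at most ε, the numerator of γ. With S, R the leading singular vectors of the noisy first
matrix, the compressed pencil at w is P diag(α_k (z_k - w)) Q + Sᴴ(E₂ - wE₁)R, where P = SᴴB and Q =
FR.

Lower bounds for P and Q (`compress_lower_bounds`): the K leading singular values are at least μ -
ε, where μ = α_min σ_min(V_L) σ_min(V_{N-L}), so S and R lie within relative distance s = γ/(1-γ) of
the noiseless ranges, and P, Q keep the Vandermonde lower bounds up to a factor √(1-s²).

Localisation (`exists_mul_norm_le_of_det_eq_zero`): by a Bauer–Fike argument every eigenvalue lies
within a chordal distance β of some node. The same argument applied to the first compressed matrix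
shows that it is invertible, so no eigenvalue is infinite.

Matching: scale the noise by τ in [0,1] with S and R fixed. At τ = 0 the eigenvalues are exactly the
nodes, and the number of them in each cluster of β-discs is constant in τ (`card_roots_mem_const`).
A bijection inside each cluster costs at most 2(K-1)β + β (`exists_perm_of_cluster_card`).

Finally (2K-1)β ≤ d/√5 (`chordalBound_estimates`), and this slack turns the chordal bound into the
Euclidean bound η (`norm_sub_le_mpEta`). -/

/-- The Euclidean norm of a complex vector. -/
def euclNorm {ι : Type*} [Fintype ι] (v : ι → ℂ) : ℝ := ‖WithLp.toLp 2 v‖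

/-! ### Euclidean norms and lower bounds of matrices. -/

section EuclNorm

variable {ι κ : Type*} [Fintype ι] [Fintype κ]

theorem euclNorm_nonneg (v : ι → ℂ) : 0 ≤ euclNorm v := norm_nonneg _

theorem euclNorm_add_le (u v : ι → ℂ) : euclNorm (u + v) ≤ euclNorm u + euclNorm v := by
  unfold euclNorm
  rw [WithLp.toLp_add]
  exact norm_add_le _ _

theorem euclNorm_neg (u : ι → ℂ) : euclNorm (-u) = euclNorm u := by
  unfold euclNorm
  rw [WithLp.toLp_neg, norm_neg]

theorem euclNorm_smul (c : ℂ) (u : ι → ℂ) : euclNorm (c • u) = ‖c‖ * euclNorm u := by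
  unfold euclNorm
  rw [WithLp.toLp_smul, norm_smul]

theorem euclNorm_sq (v : ι → ℂ) : euclNorm v ^ 2 = ∑ i, ‖v i‖ ^ 2 := by
  unfold euclNorm
  rw [EuclideanSpace.norm_sq_eq]

theorem euclNorm_pos {v : ι → ℂ} (hv : v ≠ 0) : 0 < euclNorm v := by
  unfold euclNorm
  rw [norm_pos_iff]
  simpa using hv

theorem euclNorm_zero : euclNorm (0 : ι → ℂ) = 0 := by simp [euclNorm]

theorem euclNorm_star (v : ι → ℂ) : euclNorm (star v) = euclNorm v := by
  have h : euclNorm (star v) ^ 2 = euclNorm v ^ 2 := by simp [euclNorm_sq]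
  exact (pow_left_inj₀ (euclNorm_nonneg _) (euclNorm_nonneg _) two_ne_zero).1 h

theorem star_dotProduct_self (v : ι → ℂ) : star v ⬝ᵥ v = ((euclNorm v ^ 2 : ℝ) : ℂ) := by
  rw [euclNorm_sq]
  simp only [dotProduct, Pi.star_apply, RCLike.star_def, Complex.ofReal_sum, Complex.ofReal_pow]
  exact Finset.sum_congr rfl fun i _ => Complex.conj_mul' (v i)

theorem norm_star_dotProduct_le (u v : ι → ℂ) :
    ‖star u ⬝ᵥ v‖ ≤ euclNorm u * euclNorm v := by
  have h := norm_inner_le_norm (𝕜 := ℂ) (WithLp.toLp 2 u) (WithLp.toLp 2 v)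
  rw [EuclideanSpace.inner_eq_star_dotProduct] at h
  rwa [dotProduct_comm] at h

theorem star_dotProduct_mulVec (A : Matrix ι κ ℂ) (u : ι → ℂ) (v : κ → ℂ) :
    star u ⬝ᵥ (A *ᵥ v) = star (Aᴴ *ᵥ u) ⬝ᵥ v := by
  rw [Matrix.star_mulVec, Matrix.conjTranspose_conjTranspose, Matrix.dotProduct_mulVec]

theorem euclNorm_mulVec_of_isometry [DecidableEq κ] {A : Matrix ι κ ℂ} (hA : Aᴴ * A = 1)
    (v : κ → ℂ) : euclNorm (A *ᵥ v) = euclNorm v := by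
  have h : euclNorm (A *ᵥ v) ^ 2 = euclNorm v ^ 2 := by
    have : star (A *ᵥ v) ⬝ᵥ (A *ᵥ v) = star v ⬝ᵥ v := by
      rw [star_dotProduct_mulVec, Matrix.mulVec_mulVec, hA, Matrix.one_mulVec]
    rw [star_dotProduct_self, star_dotProduct_self] at this
    exact_mod_cast this
  exact (pow_left_inj₀ (euclNorm_nonneg _) (euclNorm_nonneg _) two_ne_zero).1 h

theorem euclNorm_conjTranspose_mulVec_le {A : Matrix ι κ ℂ} {c : ℝ} (hc : 0 ≤ c)
    (hA : ∀ v, euclNorm (A *ᵥ v) ≤ c * euclNorm v) (u : ι → ℂ) :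
    euclNorm (Aᴴ *ᵥ u) ≤ c * euclNorm u := by
  by_cases h0 : Aᴴ *ᵥ u = 0
  · rw [h0, euclNorm_zero]
    exact mul_nonneg hc (euclNorm_nonneg _)
  have hpos := euclNorm_pos h0
  have h1 : star u ⬝ᵥ (A *ᵥ (Aᴴ *ᵥ u)) = ((euclNorm (Aᴴ *ᵥ u) ^ 2 : ℝ) : ℂ) := by
    rw [star_dotProduct_mulVec, star_dotProduct_self]
  have h2 := norm_star_dotProduct_le u (A *ᵥ (Aᴴ *ᵥ u))
  rw [h1, Complex.norm_real, Real.norm_of_nonneg (sq_nonneg _)] at h2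
  have h3 := mul_le_mul_of_nonneg_left (hA (Aᴴ *ᵥ u)) (euclNorm_nonneg u)
  have h4 : euclNorm (Aᴴ *ᵥ u) * euclNorm (Aᴴ *ᵥ u) ≤ (c * euclNorm u) * euclNorm (Aᴴ *ᵥ u) := by
    nlinarith
  exact le_of_mul_le_mul_right h4 hpos

theorem mulVec_surjective_of_lower_bound {A : Matrix ι ι ℂ} {c : ℝ} (hc : 0 < c)
    (hA : ∀ v, c * euclNorm v ≤ euclNorm (A *ᵥ v)) : Function.Surjective (A *ᵥ ·) := by
  have hinj : Function.Injective A.mulVecLin := by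
    rw [injective_iff_map_eq_zero]
    intro v hv
    by_contra hne
    have h1 := hA v
    rw [← Matrix.mulVecLin_apply, hv, euclNorm_zero] at h1
    exact absurd h1 (not_le.2 (mul_pos hc (euclNorm_pos hne)))
  exact LinearMap.injective_iff_surjective.1 hinj

/-- A square matrix has the same lower bound as its conjugate transpose. -/
theorem lower_bound_of_conjTranspose {A : Matrix ι ι ℂ} {c : ℝ} (hc : 0 < c)
    (hA : ∀ v, c * euclNorm v ≤ euclNorm (Aᴴ *ᵥ v)) (u : ι → ℂ) :
    c * euclNorm u ≤ euclNorm (A *ᵥ u) := by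
  by_cases hu : u = 0
  · rw [hu, euclNorm_zero, mul_zero]
    exact euclNorm_nonneg _
  -- Duality: pairing A u with a preimage v of u under Aᴴ gives ‖u‖² ≤ ‖v‖ ‖A u‖, and ‖v‖ ≤ ‖u‖ / c.
  obtain ⟨v, hv⟩ := mulVec_surjective_of_lower_bound hc hA u
  have hv' : Aᴴ *ᵥ v = u := hv
  have h1 : star v ⬝ᵥ (A *ᵥ u) = ((euclNorm u ^ 2 : ℝ) : ℂ) := by
    rw [star_dotProduct_mulVec, hv', star_dotProduct_self]
  have h2 := norm_star_dotProduct_le v (A *ᵥ u)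
  rw [h1, Complex.norm_real, Real.norm_of_nonneg (sq_nonneg _)] at h2
  have h3 := hA v
  rw [hv'] at h3
  have h4 : c * euclNorm u * euclNorm u ≤ euclNorm (A *ᵥ u) * euclNorm u := by
    nlinarith [mul_le_mul_of_nonneg_right h3 (euclNorm_nonneg (A *ᵥ u))]
  exact le_of_mul_le_mul_right h4 (euclNorm_pos hu)

/-- On the range of `C`, the conjugate transpose of `C` has the same lower bound as `C`. -/
theorem lower_bound_conjTranspose_on_range {C : Matrix ι κ ℂ} {c : ℝ} (hc : 0 < c)
    (hC : ∀ u, c * euclNorm u ≤ euclNorm (C *ᵥ u)) (u : κ → ℂ) :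
    c * euclNorm (C *ᵥ u) ≤ euclNorm (Cᴴ *ᵥ (C *ᵥ u)) := by
  by_cases h0 : C *ᵥ u = 0
  · rw [h0, euclNorm_zero, mul_zero]
    exact euclNorm_nonneg _
  have h1 : star u ⬝ᵥ (Cᴴ *ᵥ (C *ᵥ u)) = ((euclNorm (C *ᵥ u) ^ 2 : ℝ) : ℂ) := by
    rw [star_dotProduct_mulVec, Matrix.conjTranspose_conjTranspose, star_dotProduct_self]
  have h2 := norm_star_dotProduct_le u (Cᴴ *ᵥ (C *ᵥ u))
  rw [h1, Complex.norm_real, Real.norm_of_nonneg (sq_nonneg _)] at h2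
  have h3 := hC u
  have h4 : c * euclNorm (C *ᵥ u) * euclNorm (C *ᵥ u)
      ≤ euclNorm (Cᴴ *ᵥ (C *ᵥ u)) * euclNorm (C *ᵥ u) := by
    nlinarith [mul_le_mul_of_nonneg_right h3 (euclNorm_nonneg (Cᴴ *ᵥ (C *ᵥ u)))]
  exact le_of_mul_le_mul_right h4 (euclNorm_pos h0)

theorem euclNorm_sq_add_of_orthogonal {u v : ι → ℂ} (h : star u ⬝ᵥ v = 0) :
    euclNorm (u + v) ^ 2 = euclNorm u ^ 2 + euclNorm v ^ 2 := by
  have h' : star v ⬝ᵥ u = 0 := by rw [Matrix.star_dotProduct, h, star_zero]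
  have h1 : star (u + v) ⬝ᵥ (u + v) = star u ⬝ᵥ u + star v ⬝ᵥ v := by
    rw [star_add, add_dotProduct, dotProduct_add, dotProduct_add, h, h']
    ring
  rw [star_dotProduct_self, star_dotProduct_self, star_dotProduct_self] at h1
  exact_mod_cast h1

/-- If `v` is relatively `s`-close to the range of `C`, then `Cᴴ` is bounded below at `v`. -/
theorem lower_bound_conjTranspose_of_near_range {C : Matrix ι κ ℂ} {c s : ℝ} (hc : 0 < c)
    (hC : ∀ u, c * euclNorm u ≤ euclNorm (C *ᵥ u)) {v : ι → ℂ} {h : κ → ℂ}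
    (hv : euclNorm (v - C *ᵥ h) ≤ s * euclNorm v) :
    c * Real.sqrt (1 - s ^ 2) * euclNorm v ≤ euclNorm (Cᴴ *ᵥ v) := by
  have hCC : ∀ u, c ^ 2 * euclNorm u ≤ euclNorm ((Cᴴ * C) *ᵥ u) := fun u => by
    have h1 := lower_bound_conjTranspose_on_range hc hC u
    have h2 := mul_le_mul_of_nonneg_left (hC u) hc.le
    rw [← Matrix.mulVec_mulVec]
    nlinarith
  -- The vector C g solving the normal equations is the orthogonal projection of v onto the range of
  -- C. It is at least as near to v as C h is, so Pythagoras bounds it below, and Cᴴ v = Cᴴ C g.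
  obtain ⟨g, hg⟩ := mulVec_surjective_of_lower_bound (by positivity) hCC (Cᴴ *ᵥ v)
  have hg' : Cᴴ *ᵥ (C *ᵥ g) = Cᴴ *ᵥ v := by
    rw [Matrix.mulVec_mulVec]
    exact hg
  have horth : ∀ a, star (C *ᵥ a) ⬝ᵥ (v - C *ᵥ g) = 0 := fun a => by
    rw [← Matrix.conjTranspose_conjTranspose C, ← star_dotProduct_mulVec,
      Matrix.conjTranspose_conjTranspose, Matrix.mulVec_sub, hg', sub_self, dotProduct_zero]
  have e1 : euclNorm v ^ 2 = euclNorm (C *ᵥ g) ^ 2 + euclNorm (v - C *ᵥ g) ^ 2 := by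
    rw [← euclNorm_sq_add_of_orthogonal (horth g), add_sub_cancel]
  have e2 : euclNorm (v - C *ᵥ h) ^ 2
      = euclNorm (C *ᵥ (g - h)) ^ 2 + euclNorm (v - C *ᵥ g) ^ 2 := by
    rw [← euclNorm_sq_add_of_orthogonal (horth (g - h)), Matrix.mulVec_sub]
    congr 2
    abel
  have e3 : euclNorm (v - C *ᵥ h) ^ 2 ≤ s ^ 2 * euclNorm v ^ 2 := by
    rw [← mul_pow]
    exact pow_le_pow_left₀ (euclNorm_nonneg _) hv 2
  have e4 : (1 - s ^ 2) * euclNorm v ^ 2 ≤ euclNorm (C *ᵥ g) ^ 2 := by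
    nlinarith [sq_nonneg (euclNorm (C *ᵥ (g - h)))]
  have e5 : Real.sqrt (1 - s ^ 2) * euclNorm v ≤ euclNorm (C *ᵥ g) := by
    have := Real.sqrt_le_sqrt e4
    rwa [Real.sqrt_mul' _ (sq_nonneg _), Real.sqrt_sq (euclNorm_nonneg _),
      Real.sqrt_sq (euclNorm_nonneg _)] at this
  have e6 := lower_bound_conjTranspose_on_range hc hC g
  rw [hg'] at e6
  rw [mul_assoc]
  exact (mul_le_mul_of_nonneg_left e5 hc.le).trans e6

theorem euclNorm_sq_mulVec_le (A : Matrix ι κ ℂ) (v : κ → ℂ) :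
    euclNorm (A *ᵥ v) ^ 2 ≤ (∑ i, ∑ j, ‖A i j‖ ^ 2) * euclNorm v ^ 2 := by
  rw [euclNorm_sq, Finset.sum_mul]
  refine Finset.sum_le_sum fun i _ => ?_
  have h := norm_star_dotProduct_le (star (A i)) v
  rw [star_star, euclNorm_star] at h
  have := pow_le_pow_left₀ (norm_nonneg _) h 2
  rwa [mul_pow, euclNorm_sq (A i)] at this

theorem euclNorm_diagonal_mulVec_ge [DecidableEq ι] {a : ι → ℂ} {c : ℝ} (hc : 0 ≤ c)
    (ha : ∀ i, c ≤ ‖a i‖) (v : ι → ℂ) :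
    c * euclNorm v ≤ euclNorm (Matrix.diagonal a *ᵥ v) := by
  refine (pow_le_pow_iff_left₀ (mul_nonneg hc (euclNorm_nonneg _)) (euclNorm_nonneg _)
    two_ne_zero).1 ?_
  rw [mul_pow, euclNorm_sq, euclNorm_sq, Finset.mul_sum]
  refine Finset.sum_le_sum fun i _ => ?_
  rw [Matrix.mulVec_diagonal, norm_mul, mul_pow]
  exact mul_le_mul_of_nonneg_right (pow_le_pow_left₀ hc (ha i) 2) (sq_nonneg _)

theorem euclNorm_diagonal_mulVec_le [DecidableEq ι] {a : ι → ℂ} {c : ℝ} (hc : 0 ≤ c)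
    (ha : ∀ i, ‖a i‖ ≤ c) (v : ι → ℂ) :
    euclNorm (Matrix.diagonal a *ᵥ v) ≤ c * euclNorm v := by
  refine (pow_le_pow_iff_left₀ (euclNorm_nonneg _) (mul_nonneg hc (euclNorm_nonneg _))
    two_ne_zero).1 ?_
  rw [mul_pow, euclNorm_sq, euclNorm_sq, Finset.mul_sum]
  refine Finset.sum_le_sum fun i _ => ?_
  rw [Matrix.mulVec_diagonal, norm_mul, mul_pow]
  exact mul_le_mul_of_nonneg_right (pow_le_pow_left₀ (norm_nonneg _) (ha i) 2) (sq_nonneg _)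

end EuclNorm

/-! ### Smallest singular values and Vandermonde matrices. -/

section SingularValues

/-- Expanding v in an eigenbasis of T*T writes ‖T v‖² as a sum of the squared coordinates weighted
by the squared singular values, of which the last is the smallest. -/
theorem singularValues_last_mul_norm_le {E F : Type*} [NormedAddCommGroup E]
    [InnerProductSpace ℂ E] [FiniteDimensional ℂ E] [NormedAddCommGroup F]
    [InnerProductSpace ℂ F] [FiniteDimensional ℂ F] (T : E →ₗ[ℂ] F) {n : ℕ}
    (hn : Module.finrank ℂ E = n) (v : E) :
    T.singularValues (n - 1) * ‖v‖ ≤ ‖T v‖ := by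
  refine (pow_le_pow_iff_left₀ (mul_nonneg (T.singularValues_nonneg _) (norm_nonneg _))
    (norm_nonneg _) two_ne_zero).1 ?_
  have hS := T.isSymmetric_adjoint_comp_self
  set b := hS.eigenvectorBasis hn
  have h1 : ((‖T v‖ ^ 2 : ℝ) : ℂ)
      = ((∑ i, hS.eigenvalues hn i * ‖inner ℂ (b i) v‖ ^ 2 : ℝ) : ℂ) := by
    have : ((‖T v‖ ^ 2 : ℝ) : ℂ) = inner ℂ v ((T.adjoint ∘ₗ T) v) := by
      rw [LinearMap.comp_apply, LinearMap.adjoint_inner_right, inner_self_eq_norm_sq_to_K]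
      norm_cast
    rw [this, ← b.sum_inner_mul_inner, Complex.ofReal_sum]
    refine Finset.sum_congr rfl fun i _ => ?_
    rw [← hS (b i) v, hS.apply_eigenvectorBasis hn i, inner_smul_left, ← inner_conj_symm v (b i)]
    have := Complex.conj_mul' (inner ℂ (b i) v)
    rw [Complex.ofReal_mul, Complex.ofReal_pow, ← this]
    simp only [b, Complex.coe_algebraMap, Complex.conj_ofReal]
    ring
  have h2 : ‖T v‖ ^ 2 = ∑ i, hS.eigenvalues hn i * ‖inner ℂ (b i) v‖ ^ 2 := by
    exact_mod_cast h1
  rw [h2, mul_pow, ← b.sum_sq_norm_inner_right, Finset.mul_sum]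
  refine Finset.sum_le_sum fun i _ => mul_le_mul_of_nonneg_right ?_ (sq_nonneg _)
  rw [← T.sq_singularValues_fin hn i]
  exact pow_le_pow_left₀ (T.singularValues_nonneg _) (T.singularValues_antitone (by omega)) 2

theorem sigmaMin_mul_euclNorm_le {m n : ℕ} (h : n ≤ m) (A : Matrix (Fin m) (Fin n) ℂ)
    (v : Fin n → ℂ) : sigmaMin A * euclNorm v ≤ euclNorm (A *ᵥ v) := by
  have := singularValues_last_mul_norm_le (Matrix.toEuclideanLin A)
    (finrank_euclideanSpace_fin (n := n)) (WithLp.toLp 2 v)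
  rw [sigmaMin, min_eq_right h]
  exact this

theorem sigmaMin_pos {m n : ℕ} (hn : 0 < n) (h : n ≤ m) {A : Matrix (Fin m) (Fin n) ℂ}
    (hA : Function.Injective (A *ᵥ ·)) : 0 < sigmaMin A := by
  have hinj : Function.Injective (Matrix.toEuclideanLin A) := fun u v huv => by
    apply WithLp.ofLp_injective
    apply hA
    have := congrArg WithLp.ofLp huv
    simpa using this
  rw [sigmaMin, min_eq_right h]
  refine (LinearMap.injective_iff_forall_lt_finrank_singularValues_pos _).1 hinj _ ?_
  rw [finrank_euclideanSpace_fin]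
  omega

theorem one_le_condNumber {m n : ℕ} {A : Matrix (Fin m) (Fin n) ℂ} (hA : 0 < sigmaMin A) :
    1 ≤ condNumber A := by
  rw [condNumber, one_le_div hA]
  exact LinearMap.singularValues_antitone _ (Nat.zero_le _)

theorem vanderMat_mulVec_injective {K : ℕ} {M : ℕ} (h : K ≤ M) {z : Fin K → ℂ}
    (hz : Function.Injective z) : Function.Injective (vanderMat M z *ᵥ ·) := by
  intro u v huv
  have h0 : vanderMat M z *ᵥ (u - v) = 0 := by
    rw [Matrix.mulVec_sub, sub_eq_zero]
    exact huv
  have h1 : Matrix.vecMul (u - v) (Matrix.vandermonde z) = 0 := by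
    funext j
    have := congrFun h0 (Fin.castLE h j)
    simpa [Matrix.mulVec, Matrix.vecMul, dotProduct, vanderMat, Matrix.vandermonde_apply,
      mul_comm] using this
  have h2 := Matrix.eq_zero_of_vecMul_eq_zero (Matrix.det_vandermonde_ne_zero_iff.2 hz) h1
  exact sub_eq_zero.1 h2

end SingularValues

/-! ### Leading singular vectors and singular values. -/

section SVD

variable {m n K : ℕ} {A : Matrix (Fin m) (Fin n) ℂ}

theorem SVD.left_isometry (D : SVD A K) (hm : K ≤ m) : (D.left hm)ᴴ * D.left hm = 1 := by
  have h : D.Uᴴ * D.U = 1 := Matrix.mem_unitaryGroup_iff'.1 D.U_unitary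
  rw [SVD.left, Matrix.conjTranspose_submatrix]
  change (D.Uᴴ * D.U).submatrix (Fin.castLE hm) (Fin.castLE hm) = 1
  rw [h]
  exact Matrix.submatrix_one _ (Fin.castLE_injective hm)

theorem SVD.right_isometry (D : SVD A K) (hn : K ≤ n) : (D.right hn)ᴴ * D.right hn = 1 := by
  have h : D.Wᴴ * D.W = 1 := Matrix.mem_unitaryGroup_iff'.1 D.W_unitary
  rw [SVD.right, Matrix.conjTranspose_submatrix]
  change (D.Wᴴ * D.W).submatrix (Fin.castLE hn) (Fin.castLE hn) = 1
  rw [h]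
  exact Matrix.submatrix_one _ (Fin.castLE_injective hn)

theorem SVD.mul_right (D : SVD A K) (hm : K ≤ m) (hn : K ≤ n) :
    A * D.right hn
      = D.left hm * Matrix.diagonal fun i : Fin K => (D.s (Fin.castLE (le_min hm hn) i) : ℂ) := by
  have hW : D.Wᴴ * D.W = 1 := Matrix.mem_unitaryGroup_iff'.1 D.W_unitary
  have h : A * D.W = D.U * rectDiag D.s := by
    refine (congrArg (· * D.W) D.eq_mul).trans ?_
    rw [Matrix.mul_assoc, hW, Matrix.mul_one]
  ext i j
  have h1 := congrFun (congrFun h i) (Fin.castLE hn j)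
  have h2 : (A * D.right hn) i j = (A * D.W) i (Fin.castLE hn j) := rfl
  rw [h2, h1, Matrix.mul_diagonal, Matrix.mul_apply,
    Finset.sum_eq_single (Fin.castLE hm j)]
  · simp [rectDiag, SVD.left, Fin.castLE]
  · intro k _ hk
    have : (k : ℕ) ≠ (j : ℕ) := fun h => hk (Fin.ext h)
    simp [rectDiag, this]
  · simp

theorem SVD.conjTranspose_mul_left (D : SVD A K) (hm : K ≤ m) (hn : K ≤ n) :
    Aᴴ * D.left hm
      = D.right hn * Matrix.diagonal fun i : Fin K => (D.s (Fin.castLE (le_min hm hn) i) : ℂ) := by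
  have hU : D.Uᴴ * D.U = 1 := Matrix.mem_unitaryGroup_iff'.1 D.U_unitary
  have h : Aᴴ * D.U = D.W * (rectDiag D.s)ᴴ := by
    refine (congrArg (·ᴴ * D.U) D.eq_mul).trans ?_
    rw [Matrix.conjTranspose_mul, Matrix.conjTranspose_mul, Matrix.conjTranspose_conjTranspose,
      Matrix.mul_assoc, Matrix.mul_assoc, hU, Matrix.mul_one]
  ext i j
  have h1 := congrFun (congrFun h i) (Fin.castLE hm j)
  have h2 : (Aᴴ * D.left hm) i j = (Aᴴ * D.U) i (Fin.castLE hm j) := rfl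
  rw [h2, h1, Matrix.mul_diagonal, Matrix.mul_apply,
    Finset.sum_eq_single (Fin.castLE hn j)]
  · simp [rectDiag, SVD.right, Fin.castLE]
  · intro k _ hk
    have : (j : ℕ) ≠ (k : ℕ) := fun h => hk (Fin.ext h.symm)
    simp [rectDiag, this]
  · simp

theorem euclNorm_rectDiag_mulVec_le {s : Fin (min m n) → ℝ} (hs : ∀ i, 0 ≤ s i) {c : ℝ}
    (hc : 0 ≤ c) {x : Fin n → ℂ}
    (hx : ∀ i : Fin (min m n), s i ≤ c ∨ x (Fin.castLE (min_le_right _ _) i) = 0) :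
    euclNorm ((rectDiag s : Matrix (Fin m) (Fin n) ℂ) *ᵥ x) ≤ c * euclNorm x := by
  refine (pow_le_pow_iff_left₀ (euclNorm_nonneg _) (mul_nonneg hc (euclNorm_nonneg _))
    two_ne_zero).1 ?_
  have h1 : ∀ i : Fin m, ‖((rectDiag s : Matrix (Fin m) (Fin n) ℂ) *ᵥ x) i‖ ^ 2
      ≤ ∑ j : Fin n, if (i : ℕ) = (j : ℕ) then c ^ 2 * ‖x j‖ ^ 2 else 0 := by
    intro i
    by_cases hi : (i : ℕ) < n
    · have e1 : ((rectDiag s : Matrix (Fin m) (Fin n) ℂ) *ᵥ x) i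
          = (s ⟨i, lt_min i.2 hi⟩ : ℂ) * x ⟨i, hi⟩ := by
        rw [Matrix.mulVec, dotProduct, Finset.sum_eq_single (⟨i, hi⟩ : Fin n)]
        · simp [rectDiag]
        · intro j _ hj
          have : (i : ℕ) ≠ (j : ℕ) := fun h => hj (Fin.ext h.symm)
          simp [rectDiag, this]
        · simp
      have e2 : (∑ j : Fin n, if (i : ℕ) = (j : ℕ) then c ^ 2 * ‖x j‖ ^ 2 else 0)
          = c ^ 2 * ‖x ⟨i, hi⟩‖ ^ 2 := by
        rw [Finset.sum_eq_single (⟨i, hi⟩ : Fin n)]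
        · simp
        · intro j _ hj
          have : (i : ℕ) ≠ (j : ℕ) := fun h => hj (Fin.ext h.symm)
          simp [this]
        · simp
      rw [e1, e2, norm_mul, mul_pow, Complex.norm_real, Real.norm_of_nonneg (hs _)]
      rcases hx ⟨i, lt_min i.2 hi⟩ with h | h
      · exact mul_le_mul_of_nonneg_right (pow_le_pow_left₀ (hs _) h 2) (sq_nonneg _)
      · have : x ⟨i, hi⟩ = 0 := h
        simp [this]
    · have e1 : ((rectDiag s : Matrix (Fin m) (Fin n) ℂ) *ᵥ x) i = 0 := by
        rw [Matrix.mulVec, dotProduct]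
        refine Finset.sum_eq_zero fun j _ => ?_
        have : (i : ℕ) ≠ (j : ℕ) := by have := j.2; omega
        simp [rectDiag, this]
      rw [e1, norm_zero, zero_pow two_ne_zero]
      exact Finset.sum_nonneg fun j _ => by split_ifs <;> positivity
  rw [mul_pow, euclNorm_sq, euclNorm_sq, Finset.mul_sum]
  refine (Finset.sum_le_sum fun i _ => h1 i).trans ?_
  rw [Finset.sum_comm]
  refine Finset.sum_le_sum fun j _ => ?_
  by_cases hj : (j : ℕ) < m
  · rw [Finset.sum_eq_single (⟨j, hj⟩ : Fin m)]
    · simp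
    · intro i _ hi
      have : (i : ℕ) ≠ (j : ℕ) := fun h => hi (Fin.ext h)
      simp [this]
    · simp
  · rw [Finset.sum_eq_zero]
    · positivity
    · intro i _
      have : (i : ℕ) ≠ (j : ℕ) := by have := i.2; omega
      simp [this]

/-- If `A` is bounded below by `μ` on the range of an injective `n × K` matrix, then its `K` largest
singular values are at least `μ`. -/
theorem SVD.le_singularValue (D : SVD A K) (hm : K ≤ m) (hn : K ≤ n)
    {C : Matrix (Fin n) (Fin K) ℂ} (hC : Function.Injective (C *ᵥ ·)) {μ : ℝ}
    (hμ : ∀ u, μ * euclNorm (C *ᵥ u) ≤ euclNorm (A *ᵥ (C *ᵥ u))) (i₀ : Fin K) :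
    μ ≤ D.s (Fin.castLE (le_min hm hn) i₀) := by
  -- Min-max argument: K-1 linear conditions on K unknowns leave a nonzero u for which C u is
  -- orthogonal to every leading right singular vector except the one with index i₀. On the
  -- coordinates that remain, no singular value exceeds the one at i₀.
  set f : (Fin K → ℂ) →ₗ[ℂ] ({i : Fin K // i ≠ i₀} → ℂ) :=
    (LinearMap.funLeft ℂ ℂ fun i : {i : Fin K // i ≠ i₀} => Fin.castLE hn i.1) ∘ₗ
      (D.Wᴴ * C).mulVecLin with hf
  have hker : LinearMap.ker f ≠ ⊥ := by
    refine LinearMap.ker_ne_bot_of_finrank_lt ?_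
    have := i₀.2
    simp only [Module.finrank_fintype_fun_eq_card, Fintype.card_fin, Fintype.card_subtype_compl,
      Fintype.card_unique, ne_eq]
    omega
  obtain ⟨u, hu, hu0⟩ := Submodule.exists_mem_ne_zero_of_ne_bot hker
  have hCu : C *ᵥ u ≠ 0 := fun h => hu0 (hC (by simpa using h))
  have hcoord : ∀ i : Fin K, i ≠ i₀ → (D.Wᴴ *ᵥ (C *ᵥ u)) (Fin.castLE hn i) = 0 := by
    intro i hi
    have := congrFun (LinearMap.mem_ker.1 hu) ⟨i, hi⟩
    rw [Matrix.mulVec_mulVec]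
    exact this
  have hUU : D.Uᴴ * D.U = 1 := Matrix.mem_unitaryGroup_iff'.1 D.U_unitary
  have hWW : (D.Wᴴ)ᴴ * D.Wᴴ = 1 := by
    rw [Matrix.conjTranspose_conjTranspose]
    exact Matrix.mem_unitaryGroup_iff.1 D.W_unitary
  have e1 : A *ᵥ (C *ᵥ u) = D.U *ᵥ (rectDiag D.s *ᵥ (D.Wᴴ *ᵥ (C *ᵥ u))) := by
    refine (congrArg (· *ᵥ (C *ᵥ u)) D.eq_mul).trans ?_
    simp only [Matrix.mulVec_mulVec, Matrix.mul_assoc]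
  have e2 := hμ u
  rw [e1, euclNorm_mulVec_of_isometry hUU] at e2
  have e3 : euclNorm (rectDiag D.s *ᵥ (D.Wᴴ *ᵥ (C *ᵥ u)))
      ≤ D.s (Fin.castLE (le_min hm hn) i₀) * euclNorm (D.Wᴴ *ᵥ (C *ᵥ u)) := by
    refine euclNorm_rectDiag_mulVec_le D.s_nonneg (D.s_nonneg _) fun i => ?_
    by_cases hi : (i : ℕ) < K
    · by_cases hi0 : (⟨i, hi⟩ : Fin K) = i₀
      · left
        rw [← hi0]
        exact le_of_eq rfl
      · right
        exact hcoord ⟨i, hi⟩ hi0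
    · left
      exact D.s_le _ _ i₀.2 (not_lt.1 hi)
  rw [euclNorm_mulVec_of_isometry hWW] at e3
  exact le_of_mul_le_mul_right (e2.trans e3) (euclNorm_pos hCu)

end SVD

/-! ### Singular vectors against the noiseless range. -/

section Subspace

variable {ι κ ι' : Type*} [Fintype ι] [Fintype κ] [Fintype ι'] [DecidableEq κ]

/-- Singular vectors of `B * F + E` are close to the range of `B`. -/
theorem exists_near_range {A E : Matrix ι ι' ℂ} {S B : Matrix ι κ ℂ} {R : Matrix ι' κ ℂ}
    {F : Matrix κ ι' ℂ} {s : κ → ℝ} {ε μ : ℝ} (hS : Sᴴ * S = 1) (hR : Rᴴ * R = 1)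
    (hAR : A * R = S * Matrix.diagonal fun i => (s i : ℂ)) (hA : A = B * F + E)
    (hE : ∀ v, euclNorm (E *ᵥ v) ≤ ε * euclNorm v) (hε : 0 ≤ ε) (hμ : 0 < μ) (hs : ∀ i, μ ≤ s i)
    (y : κ → ℂ) : ∃ h, euclNorm (S *ᵥ y - B *ᵥ h) ≤ ε / μ * euclNorm (S *ᵥ y) := by
  -- Inverting the singular values gives S y = A R y'. The B-part of A stays in the range of B, and
  -- the E-part has norm at most ε ‖y'‖ ≤ (ε/μ) ‖y‖.
  set y' := Matrix.diagonal (fun i => ((s i)⁻¹ : ℂ)) *ᵥ y with hy'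
  have hyy' : Matrix.diagonal (fun i => (s i : ℂ)) *ᵥ y' = y := by
    rw [hy', Matrix.mulVec_mulVec, Matrix.diagonal_mul_diagonal]
    have : (fun i => (s i : ℂ) * (s i : ℂ)⁻¹) = fun _ => 1 := by
      funext i
      exact mul_inv_cancel₀ (Complex.ofReal_ne_zero.2 (hμ.trans_le (hs i)).ne')
    rw [this, Matrix.diagonal_one, Matrix.one_mulVec]
  have hSy : S *ᵥ y = B *ᵥ (F *ᵥ (R *ᵥ y')) + E *ᵥ (R *ᵥ y') := by
    conv_lhs => rw [← hyy']
    rw [Matrix.mulVec_mulVec, ← hAR, hA]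
    simp only [Matrix.mulVec_mulVec, Matrix.add_mul, Matrix.add_mulVec, Matrix.mul_assoc]
  refine ⟨F *ᵥ (R *ᵥ y'), ?_⟩
  have h1 : S *ᵥ y - B *ᵥ (F *ᵥ (R *ᵥ y')) = E *ᵥ (R *ᵥ y') := by
    rw [hSy, add_sub_cancel_left]
  rw [h1, euclNorm_mulVec_of_isometry hS]
  refine (hE _).trans ?_
  rw [euclNorm_mulVec_of_isometry hR, div_mul_eq_mul_div, mul_div_assoc]
  refine mul_le_mul_of_nonneg_left ?_ hε
  rw [div_eq_inv_mul]
  refine euclNorm_diagonal_mulVec_le (inv_nonneg.2 hμ.le) (fun i => ?_) y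
  rw [norm_inv, Complex.norm_real, Real.norm_of_nonneg (hμ.le.trans (hs i))]
  exact inv_anti₀ hμ (hs i)

end Subspace

/-! ### A Bauer–Fike bound. -/

section Pencil

variable {ι κ : Type*} [Fintype ι] [Fintype κ] [DecidableEq κ]

theorem lower_bound_conjTranspose_mul {S B : Matrix ι κ ℂ} {c s : ℝ} (hS : Sᴴ * S = 1)
    (hc : 0 < c) (hB : ∀ u, c * euclNorm u ≤ euclNorm (B *ᵥ u))
    (hSB : ∀ y, ∃ h, euclNorm (S *ᵥ y - B *ᵥ h) ≤ s * euclNorm (S *ᵥ y)) (y : κ → ℂ) :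
    c * Real.sqrt (1 - s ^ 2) * euclNorm y ≤ euclNorm ((Bᴴ * S) *ᵥ y) := by
  obtain ⟨h, hh⟩ := hSB y
  have := lower_bound_conjTranspose_of_near_range hc hB hh
  rwa [euclNorm_mulVec_of_isometry hS, Matrix.mulVec_mulVec] at this

/-- A Bauer–Fike bound. -/
theorem exists_mul_norm_le_of_det_eq_zero {P Q F : Matrix κ κ ℂ} {a : κ → ℂ} {p q f : ℝ}
    (hp : 0 ≤ p) (hP : ∀ u, p * euclNorm u ≤ euclNorm (P *ᵥ u))
    (hQ : ∀ u, q * euclNorm u ≤ euclNorm (Q *ᵥ u))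
    (hF : ∀ u, euclNorm (F *ᵥ u) ≤ f * euclNorm u)
    (hdet : (P * Matrix.diagonal a * Q + F).det = 0) : ∃ k, p * q * ‖a k‖ ≤ f := by
  obtain ⟨y, hy0, hy⟩ := Matrix.exists_mulVec_eq_zero_iff.2 hdet
  have : Nonempty κ := by
    by_contra h
    rw [not_nonempty_iff] at h
    exact hy0 (Subsingleton.elim _ _)
  obtain ⟨k, hk⟩ := Finite.exists_min fun k => ‖a k‖
  refine ⟨k, ?_⟩
  have h1 : P *ᵥ (Matrix.diagonal a *ᵥ (Q *ᵥ y)) = -(F *ᵥ y) := by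
    rw [Matrix.add_mulVec, add_eq_zero_iff_eq_neg] at hy
    rw [← hy]
    simp only [Matrix.mulVec_mulVec, Matrix.mul_assoc]
  have h2 := hP (Matrix.diagonal a *ᵥ (Q *ᵥ y))
  rw [h1, euclNorm_neg] at h2
  have h3 := mul_le_mul_of_nonneg_left
    (euclNorm_diagonal_mulVec_ge (norm_nonneg _) hk (Q *ᵥ y)) hp
  have h4 := mul_le_mul_of_nonneg_left (hQ y) (mul_nonneg hp (norm_nonneg (a k)))
  refine le_of_mul_le_mul_right ?_ (euclNorm_pos hy0)
  calc p * q * ‖a k‖ * euclNorm y = p * ‖a k‖ * (q * euclNorm y) := by ring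
    _ ≤ p * ‖a k‖ * euclNorm (Q *ᵥ y) := h4
    _ = p * (‖a k‖ * euclNorm (Q *ᵥ y)) := by ring
    _ ≤ _ := h3
    _ ≤ _ := h2
    _ ≤ _ := hF y

end Pencil

/-! ### The characteristic polynomial of a pencil. -/

section PencilPoly

variable {K : ℕ}

/-- The form X A + B is the one for which a degree bound and the coefficient of order K are known.
-/
theorem pencilPoly_eq (A B : Matrix (Fin K) (Fin K) ℂ) :
    pencilPoly A B = ((Polynomial.X : Polynomial ℂ) • (-A).map Polynomial.C
      + B.map Polynomial.C).det := by
  rw [pencilPoly]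
  congr 1
  refine Matrix.ext fun i j => ?_
  simp only [Matrix.sub_apply, Matrix.map_apply, Matrix.smul_apply, Matrix.add_apply,
    Matrix.neg_apply, smul_eq_mul, map_neg]
  ring

theorem pencilPoly_eval (A B : Matrix (Fin K) (Fin K) ℂ) (x : ℂ) :
    (pencilPoly A B).eval x = (B - x • A).det := by
  rw [pencilPoly, ← Polynomial.coe_evalRingHom, RingHom.map_det]
  congr 1
  ext i j
  simp only [RingHom.mapMatrix_apply, Matrix.map_apply, Matrix.sub_apply, Matrix.smul_apply,
    smul_eq_mul, Polynomial.coe_evalRingHom, Polynomial.eval_sub, Polynomial.eval_mul,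
    Polynomial.eval_C, Polynomial.eval_X]

theorem pencilPoly_coeff (A B : Matrix (Fin K) (Fin K) ℂ) :
    (pencilPoly A B).coeff K = (-A).det := by
  have := Polynomial.coeff_det_X_add_C_card (-A) B
  rwa [Fintype.card_fin, ← pencilPoly_eq] at this

theorem det_neg_ne_zero {A : Matrix (Fin K) (Fin K) ℂ} (hA : A.det ≠ 0) : (-A).det ≠ 0 := by
  rw [Matrix.det_neg]
  exact mul_ne_zero (pow_ne_zero _ (neg_ne_zero.2 one_ne_zero)) hA

theorem pencilPoly_natDegree {A : Matrix (Fin K) (Fin K) ℂ} (hA : A.det ≠ 0)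
    (B : Matrix (Fin K) (Fin K) ℂ) : (pencilPoly A B).natDegree = K := by
  refine le_antisymm ?_ (Polynomial.le_natDegree_of_ne_zero ?_)
  · have := Polynomial.natDegree_det_X_add_C_le (-A) B
    rwa [Fintype.card_fin, ← pencilPoly_eq] at this
  · rw [pencilPoly_coeff]
    exact det_neg_ne_zero hA

theorem exists_map_eq_of_card {β : Type*} {s : Multiset β} {n : ℕ} (hs : s.card = n) :
    ∃ r : Fin n → β, Finset.univ.val.map r = s := by
  subst hs
  induction s using Quotient.inductionOn with
  | h l =>
    refine ⟨l.get, ?_⟩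
    rw [Fin.univ_def]
    simp

theorem exists_roots_pencilPoly {A : Matrix (Fin K) (Fin K) ℂ} (hA : A.det ≠ 0)
    (B : Matrix (Fin K) (Fin K) ℂ) :
    ∃ r : Fin K → ℂ, Finset.univ.val.map r = (pencilPoly A B).roots ∧
      ∀ x, (B - x • A).det = (-A).det * ∏ i, (x - r i) := by
  have hcard : (pencilPoly A B).roots.card = (pencilPoly A B).natDegree :=
    (IsAlgClosed.splits (pencilPoly A B)).natDegree_eq_card_roots.symm
  obtain ⟨r, hr⟩ := exists_map_eq_of_card (hcard.trans (pencilPoly_natDegree hA B))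
  refine ⟨r, hr, fun x => ?_⟩
  have h := Polynomial.C_leadingCoeff_mul_prod_multiset_X_sub_C hcard
  rw [← pencilPoly_eval, ← h, ← hr, Polynomial.leadingCoeff, pencilPoly_natDegree hA,
    pencilPoly_coeff, Polynomial.eval_mul, Polynomial.eval_C, Multiset.map_map]
  congr 1
  rw [show (Multiset.map ((fun a => Polynomial.X - Polynomial.C a) ∘ r) Finset.univ.val).prod
    = ∏ i, (Polynomial.X - Polynomial.C (r i)) from rfl, Polynomial.eval_prod]
  simp

end PencilPoly

/-! ### Continuity of root counts. -/

section RootCount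

open Filter Topology

theorem map_eq_of_prod_sub_eq {n : ℕ} {a b : Fin n → ℂ}
    (h : ∀ x : ℂ, ∏ i, (x - a i) = ∏ i, (x - b i)) :
    Finset.univ.val.map a = Finset.univ.val.map b := by
  have hp : ((Finset.univ.val.map a).map fun w => Polynomial.X - Polynomial.C w).prod
      = ((Finset.univ.val.map b).map fun w => Polynomial.X - Polynomial.C w).prod := by
    refine Polynomial.funext fun x => ?_
    rw [Multiset.map_map, Multiset.map_map]
    change Polynomial.eval x (∏ i, (Polynomial.X - Polynomial.C (a i)))
      = Polynomial.eval x (∏ i, (Polynomial.X - Polynomial.C (b i)))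
    rw [Polynomial.eval_prod, Polynomial.eval_prod]
    simpa using h x
  rw [← Polynomial.roots_multiset_prod_X_sub_C (Finset.univ.val.map a), hp,
    Polynomial.roots_multiset_prod_X_sub_C]

open Classical in
theorem card_filter_eq_of_map_eq {n : ℕ} {β : Type*} {a b : Fin n → β}
    (h : Finset.univ.val.map a = Finset.univ.val.map b) (U : Set β) :
    (Finset.univ.filter fun i => a i ∈ U).card = (Finset.univ.filter fun i => b i ∈ U).card := by
  have := congrArg (Multiset.countP (· ∈ U)) h
  rwa [Multiset.countP_map, Multiset.countP_map] at this

open Classical in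
/-- The number of roots in `U` of a polynomial that depends continuously on a parameter is constant
as long as all roots stay in the union of the disjoint compact sets `U` and `V`. -/
theorem card_roots_mem_const {T : Type*} [TopologicalSpace T] [PreconnectedSpace T] {n : ℕ}
    {f : T → ℂ → ℂ} (hf : ∀ x, Continuous fun t => f t x) {c : T → ℂ} (hc : Continuous c)
    (hc0 : ∀ t, c t ≠ 0) {r : T → Fin n → ℂ} (hr : ∀ t x, f t x = c t * ∏ i, (x - r t i))
    {U V : Set ℂ} (hU : IsCompact U) (hV : IsCompact V) (hUV : Disjoint U V)
    (hmem : ∀ t i, r t i ∈ U ∪ V) (t t' : T) :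
    (Finset.univ.filter fun i => r t i ∈ U).card
      = (Finset.univ.filter fun i => r t' i ∈ U).card := by
  have hcont : Continuous fun t => (Finset.univ.filter fun i => r t i ∈ U).card := by
    -- The enumeration of the roots need not be continuous in the parameter. Along an ultrafilter,
    -- compactness makes each listed root converge, and since U and V are closed and disjoint its
    -- limit decides on which side it eventually lies.
    rw [continuous_iff_ultrafilter]
    intro t₀ g hg
    have hlim : ∀ i, ∃ a, Tendsto (fun t => r t i) g (𝓝 a) := fun i => by
      obtain ⟨a, -, ha⟩ := (hU.union hV).ultrafilter_le_nhds (g.map fun t => r t i)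
        (by
          rw [le_principal_iff]
          change ∀ᶠ t in (g : Filter T), r t i ∈ U ∪ V
          exact Eventually.of_forall fun t => hmem t i)
      exact ⟨a, ha⟩
    choose a ha using hlim
    have hiff : ∀ i, ∀ᶠ t in (g : Filter T), (r t i ∈ U ↔ a i ∈ U) := by
      intro i
      rcases Ultrafilter.em g (fun t => r t i ∈ U) with h | h
      · have haU : a i ∈ U := hU.isClosed.mem_of_tendsto (ha i) h
        exact h.mono fun t ht => ⟨fun _ => haU, fun _ => ht⟩
      · have haV : a i ∈ V := hV.isClosed.mem_of_tendsto (ha i)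
          (h.mono fun t ht => (hmem t i).resolve_left ht)
        have haU : a i ∉ U := fun h => Set.disjoint_left.1 hUV h haV
        exact h.mono fun t ht => ⟨fun h => absurd h ht, fun h => absurd h haU⟩
    -- Passing to the limit in the factorisation shows that the limits are the roots at t₀ with
    -- multiplicity.
    have hroots : ∀ x, ∏ i, (x - a i) = ∏ i, (x - r t₀ i) := by
      intro x
      have h1 : Tendsto (fun t => f t x) g (𝓝 (f t₀ x)) := ((hf x).tendsto t₀).mono_left hg
      have h2 : Tendsto (fun t => f t x) g (𝓝 (c t₀ * ∏ i, (x - a i))) := by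
        simp only [hr]
        exact ((hc.tendsto t₀).mono_left hg).mul
          (tendsto_finsetProd _ fun i _ => tendsto_const_nhds.sub (ha i))
      have h3 := tendsto_nhds_unique h2 h1
      rw [hr] at h3
      exact mul_left_cancel₀ (hc0 t₀) h3
    have hcard := card_filter_eq_of_map_eq (map_eq_of_prod_sub_eq hroots) U
    refine tendsto_nhds_of_eventually_eq ?_
    filter_upwards [eventually_all.2 hiff] with t ht
    rw [← hcard]
    simp only [ht]
  exact PreconnectedSpace.constant ‹_› hcont

end RootCount

/-! ### Matching points inside clusters. -/

section Matching

variable {X : Type*} {K : ℕ}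

/-- Points of the same cluster are joined by chains of at most `K - 1` steps. -/
theorem dist_le_of_walk {δ : X → X → ℝ} (hself : ∀ x, δ x x = 0)
    (htri : ∀ x y v, δ x v ≤ δ x y + δ y v) {z : Fin K → X} {b : ℝ} {G : SimpleGraph (Fin K)}
    (hG : ∀ k l, G.Adj k l → δ (z k) (z l) ≤ b) {k l : Fin K} (p : G.Walk k l) :
    δ (z k) (z l) ≤ p.length * b := by
  induction p with
  | nil => simp [hself]
  | cons h p ih =>
    rw [SimpleGraph.Walk.length_cons]
    push_cast
    linarith [htri (z _) (z _) (z _) |>.trans (add_le_add (hG _ _ h) ih)]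

-- The clusters are the components of the graph joining nodes at distance at most 2β, so discs of
-- radius β about different clusters are disjoint. Each cluster therefore owns as many points of w
-- as it has nodes, which yields a bijection cluster by cluster.
open Classical in
theorem exists_perm_of_cluster_card {δ : X → X → ℝ} (hself : ∀ x, δ x x = 0)
    (hsymm : ∀ x y, δ x y = δ y x) (htri : ∀ x y v, δ x v ≤ δ x y + δ y v) {z w : Fin K → X}
    {β : ℝ} (hβ : 0 ≤ β) (hclose : ∀ j, ∃ k, δ (z k) (w j) ≤ β)
    (hcard : ∀ C : Set (Fin K), (∀ k ∈ C, ∀ l ∉ C, 2 * β < δ (z k) (z l)) →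
      (Finset.univ.filter fun j => ∃ k ∈ C, δ (z k) (w j) ≤ β).card
        = (Finset.univ.filter fun k => k ∈ C).card) :
    ∃ π : Equiv.Perm (Fin K), ∀ k, δ (z k) (w (π k)) ≤ (2 * K - 1) * β := by
  let G : SimpleGraph (Fin K) :=
    { Adj := fun k l => k ≠ l ∧ δ (z k) (z l) ≤ 2 * β
      symm := ⟨fun k l h => ⟨h.1.symm, hsymm (z k) (z l) ▸ h.2⟩⟩
      loopless := ⟨fun k h => h.1 rfl⟩ }
  have hcomp : ∀ k l, δ (z k) (z l) ≤ 2 * β →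
      G.connectedComponentMk k = G.connectedComponentMk l := by
    intro k l h
    by_cases hkl : k = l
    · rw [hkl]
    · exact SimpleGraph.ConnectedComponent.sound (SimpleGraph.Adj.reachable (G := G) ⟨hkl, h⟩)
  choose near hnear using hclose
  have hfib : ∀ c : G.ConnectedComponent,
      Nonempty ({k // G.connectedComponentMk k = c} ≃
        {j // G.connectedComponentMk (near j) = c}) := by
    intro c
    have h := hcard {k | G.connectedComponentMk k = c} fun k hk l hl => by
      by_contra hle
      exact hl ((hcomp k l (not_lt.1 hle)).symm.trans hk)
    rw [← Fintype.card_eq, Fintype.card_subtype, Fintype.card_subtype]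
    refine h.symm.trans (congrArg Finset.card (Finset.filter_congr fun j _ => ?_))
    refine ⟨fun ⟨k, hk, hkj⟩ => ?_, fun hj => ⟨near j, hj, hnear j⟩⟩
    rw [← show G.connectedComponentMk k = c from hk]
    refine hcomp _ _ ?_
    have := htri (z (near j)) (w j) (z k)
    rw [hsymm (w j)] at this
    linarith [hnear j]
  refine ⟨Equiv.ofFiberEquiv fun c => (hfib c).some, fun k => ?_⟩
  set j := Equiv.ofFiberEquiv (fun c => (hfib c).some) k
  have hj : G.connectedComponentMk k = G.connectedComponentMk (near j) :=
    (Equiv.ofFiberEquiv_map (fun c => (hfib c).some) k).symm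
  obtain ⟨p, hp⟩ := (SimpleGraph.ConnectedComponent.exact hj).exists_isPath
  have hlen : (p.length : ℝ) + 1 ≤ K := by
    have := hp.length_lt
    rw [Fintype.card_fin] at this
    exact_mod_cast this
  have h1 := dist_le_of_walk hself htri (fun k l (h : G.Adj k l) => h.2) p
  have h2 := htri (z k) (z (near j)) (w j)
  -- A path has at most K-1 edges of length at most 2β, and the last hop from a node to its nearby
  -- point costs β.
  nlinarith [hnear j]

end Matching

/-! ### The chordal metric and its comparison with the Euclidean one. -/

section Chordal

/-- The chordal distance of two complex numbers. -/
def chord (z w : ℂ) : ℝ := ‖z - w‖ / (Real.sqrt (1 + ‖z‖ ^ 2) * Real.sqrt (1 + ‖w‖ ^ 2))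

theorem sqrt_one_add_sq_pos (z : ℂ) : 0 < Real.sqrt (1 + ‖z‖ ^ 2) :=
  Real.sqrt_pos.2 (by positivity)

theorem chord_self (z : ℂ) : chord z z = 0 := by simp [chord]

theorem chord_comm (z w : ℂ) : chord z w = chord w z := by
  rw [chord, chord, norm_sub_rev, mul_comm]

theorem chord_le_iff (z w : ℂ) (b : ℝ) :
    chord z w ≤ b ↔ ‖z - w‖ ≤ b * (Real.sqrt (1 + ‖z‖ ^ 2) * Real.sqrt (1 + ‖w‖ ^ 2)) :=
  div_le_iff₀ (mul_pos (sqrt_one_add_sq_pos z) (sqrt_one_add_sq_pos w))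

theorem norm_one_add_mul_conj_le (z v : ℂ) :
    ‖1 + z * (starRingEnd ℂ) v‖ ≤ Real.sqrt (1 + ‖z‖ ^ 2) * Real.sqrt (1 + ‖v‖ ^ 2) := by
  refine (norm_add_le _ _).trans ?_
  rw [norm_one, norm_mul, RCLike.norm_conj, ← Real.sqrt_mul (by positivity)]
  refine Real.le_sqrt_of_sq_le ?_
  nlinarith [sq_nonneg (‖z‖ - ‖v‖)]

theorem chord_triangle (z v w : ℂ) : chord z w ≤ chord z v + chord v w := by
  have hz := sqrt_one_add_sq_pos z
  have hv := sqrt_one_add_sq_pos v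
  have hw := sqrt_one_add_sq_pos w
  have hv2 : Real.sqrt (1 + ‖v‖ ^ 2) ^ 2 = 1 + ‖v‖ ^ 2 := Real.sq_sqrt (by positivity)
  -- Once divided by 1 + |v|², this identity is the triangle inequality, with Cauchy–Schwarz
  -- bounding the two mixed factors.
  have hid : (z - w) * (1 + v * (starRingEnd ℂ) v)
      = (z - v) * (1 + w * (starRingEnd ℂ) v) + (v - w) * (1 + z * (starRingEnd ℂ) v) := by ring
  have hn : ‖(1 : ℂ) + v * (starRingEnd ℂ) v‖ = Real.sqrt (1 + ‖v‖ ^ 2) ^ 2 := by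
    rw [hv2, Complex.mul_conj']
    have : (1 : ℂ) + (‖v‖ : ℂ) ^ 2 = ((1 + ‖v‖ ^ 2 : ℝ) : ℂ) := by push_cast; rfl
    rw [this, Complex.norm_real, Real.norm_of_nonneg (by positivity)]
  have h := congrArg norm hid
  rw [norm_mul, hn] at h
  have h1 := norm_add_le ((z - v) * (1 + w * (starRingEnd ℂ) v))
    ((v - w) * (1 + z * (starRingEnd ℂ) v))
  rw [← h, norm_mul, norm_mul] at h1
  have h2 := mul_le_mul_of_nonneg_left (norm_one_add_mul_conj_le w v) (norm_nonneg (z - v))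
  have h3 := mul_le_mul_of_nonneg_left (norm_one_add_mul_conj_le z v) (norm_nonneg (v - w))
  rw [chord, chord, chord, div_add_div _ _ (by positivity) (by positivity),
    div_le_div_iff₀ (by positivity) (by positivity)]
  set a := Real.sqrt (1 + ‖z‖ ^ 2)
  set b := Real.sqrt (1 + ‖v‖ ^ 2)
  set c := Real.sqrt (1 + ‖w‖ ^ 2)
  have h4 : ‖z - w‖ * b ^ 2 ≤ ‖z - v‖ * (c * b) + ‖v - w‖ * (a * b) := by linarith
  calc ‖z - w‖ * (a * b * (b * c)) = ‖z - w‖ * b ^ 2 * (a * c) := by ring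
    _ ≤ (‖z - v‖ * (c * b) + ‖v - w‖ * (a * b)) * (a * c) :=
        mul_le_mul_of_nonneg_right h4 (by positivity)
    _ = _ := by ring

/-- Chordal discs of radius less than one half about points of the unit disc are compact. -/
theorem isCompact_chord_le {z : ℂ} (hz : ‖z‖ ≤ 1) {b : ℝ} (hb : b ≤ 1 / 2) :
    IsCompact {w | chord z w ≤ b} := by
  have hset : {w | chord z w ≤ b}
      = {w | ‖z - w‖ ≤ b * (Real.sqrt (1 + ‖z‖ ^ 2) * Real.sqrt (1 + ‖w‖ ^ 2))} :=
    Set.ext fun w => chord_le_iff z w b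
  refine Metric.isCompact_of_isClosed_isBounded ?_ ?_
  · rw [hset]
    exact isClosed_le (by fun_prop) (by fun_prop)
  -- The point at infinity is at chordal distance 1/√(1+|z|²) ≥ 1/√2 from z, so the disc is bounded.
  -- The estimates below give |w| ≤ 7.
  · refine (Metric.isBounded_closedBall (x := (0 : ℂ)) (r := 8)).subset fun w hw => ?_
    rw [hset, Set.mem_ofPred_eq] at hw
    rw [mem_closedBall_zero_iff]
    have h1 : Real.sqrt (1 + ‖z‖ ^ 2) ≤ 3 / 2 := by
      rw [Real.sqrt_le_left (by norm_num)]
      nlinarith [norm_nonneg z]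
    have h2 : Real.sqrt (1 + ‖w‖ ^ 2) ≤ 1 + ‖w‖ := by
      rw [Real.sqrt_le_left (by positivity)]
      nlinarith [norm_nonneg w]
    have h3 : ‖w‖ - ‖z‖ ≤ ‖z - w‖ := by
      rw [norm_sub_rev]
      exact norm_sub_norm_le w z
    have h4 : b * (Real.sqrt (1 + ‖z‖ ^ 2) * Real.sqrt (1 + ‖w‖ ^ 2))
        ≤ 1 / 2 * (3 / 2 * (1 + ‖w‖)) := by
      gcongr
    linarith

/-- A chordal error that is smaller than `d` by a factor `√5` gives an error of at most
`mpEta d r`. -/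
theorem norm_sub_le_mpEta {z w : ℂ} {b d : ℝ} (hz : ‖z‖ ≤ 1) (hd : 0 ≤ d)
    (hd2 : d ^ 2 < 1 / 2) (hbd : 5 * b ^ 2 ≤ d ^ 2) (h : chord z w ≤ b) :
    ‖z - w‖ ≤ mpEta d ‖z‖ := by
  rw [chord_le_iff] at h
  set r := ‖z‖ with hr
  have hr0 : 0 ≤ r := norm_nonneg z
  set δ := ‖z - w‖ with hδ
  have hδ0 : 0 ≤ δ := norm_nonneg _
  set c := Real.sqrt (1 - d ^ 2) with hc
  have hc2 : c ^ 2 = 1 - d ^ 2 := Real.sq_sqrt (by linarith)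
  have hc0 : 0 < c := Real.sqrt_pos.2 (by linarith)
  have hdc : d ≤ c := by
    refine (pow_le_pow_iff_left₀ hd hc0.le two_ne_zero).1 ?_
    linarith
  have hr2 : r ^ 2 ≤ 1 := pow_le_one₀ hr0 hz
  have hden : 0 < 1 - d ^ 2 * (1 + r ^ 2) := by nlinarith [sq_nonneg d]
  have heta : mpEta d r = d * (1 + r ^ 2) * (c - d * r) / (1 - d ^ 2 * (1 + r ^ 2)) := by
    rw [mpEta, ← hc]
    field_simp
    ring
  have hfac : 1 - d ^ 2 * (1 + r ^ 2) = (c - d * r) * (c + d * r) := by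
    linear_combination -hc2
  have hpos : 0 < c + d * r := by positivity
  have hpos' : 0 < c - d * r := by
    by_contra hle
    rw [hfac] at hden
    nlinarith
  -- With r = tan φ and d = sin θ this is tan φ - tan(φ-θ), the distance from z to the boundary of
  -- its chordal d-disc in the direction of the origin. Outwards the disc reaches further, so a
  -- chordal error d alone would not suffice. This is what the factor √5 pays for.
  have heta' : mpEta d r = d * (1 + r ^ 2) / (c + d * r) := by
    rw [heta, hfac]
    field_simp
  rw [heta', le_div_iff₀ hpos]
  by_contra hlt
  rw [not_le] at hlt
  have hw : ‖w‖ ≤ r + δ := by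
    have := norm_sub_norm_le w z
    rw [norm_sub_rev] at this
    linarith
  have h2 : δ ^ 2 ≤ b ^ 2 * ((1 + r ^ 2) * (1 + (r + δ) ^ 2)) := by
    have h3 := pow_le_pow_left₀ hδ0 h 2
    rw [mul_pow, mul_pow, Real.sq_sqrt (by positivity), Real.sq_sqrt (by positivity)] at h3
    have h4 := pow_le_pow_left₀ (norm_nonneg w) hw 2
    refine h3.trans ?_
    gcongr
  -- In this variable 1 + (r+δ)² = (1+r²)((1+rx)² + x²), so the powers of 1+r² cancel.
  set x := δ / (1 + r ^ 2) with hx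
  have ha : 0 < 1 + r ^ 2 := by positivity
  have hδx : δ = x * (1 + r ^ 2) := by rw [hx, div_mul_cancel₀ _ ha.ne']
  have hx0 : 0 ≤ x := by positivity
  have h5 : x ^ 2 ≤ b ^ 2 * ((1 + r * x) ^ 2 + x ^ 2) := by
    have : x ^ 2 * (1 + r ^ 2) ^ 2 ≤ b ^ 2 * ((1 + r * x) ^ 2 + x ^ 2) * (1 + r ^ 2) ^ 2 := by
      rw [hδx] at h2
      calc x ^ 2 * (1 + r ^ 2) ^ 2 = (x * (1 + r ^ 2)) ^ 2 := by ring
        _ ≤ _ := h2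
        _ = _ := by ring
    exact le_of_mul_le_mul_right this (by positivity)
  have h6 : 5 * x ^ 2 ≤ d ^ 2 * ((1 + r * x) ^ 2 + x ^ 2) := by
    have := mul_le_mul_of_nonneg_right hbd (show 0 ≤ (1 + r * x) ^ 2 + x ^ 2 by positivity)
    linarith
  have h7 : d < (c + d * r) * x := by
    rw [hδx] at hlt
    have : d * (1 + r ^ 2) < (c + d * r) * x * (1 + r ^ 2) := by linarith
    exact lt_of_mul_lt_mul_right this ha.le
  have h8 : d * (1 + r * x) < (c + 2 * d * r) * x := by linarith
  have h9 := pow_lt_pow_left₀ h8 (by positivity) two_ne_zero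
  have hx2 : 0 < x ^ 2 := by
    have : x ≠ 0 := by
      rintro h0
      rw [h0, mul_zero] at h7
      linarith
    positivity
  have h10 : 5 - d ^ 2 < (c + 2 * d * r) ^ 2 := by
    refine lt_of_mul_lt_mul_right (a := x ^ 2) ?_ hx2.le
    rw [mul_pow, mul_pow] at h9
    linarith
  have h11 : (c + 2 * d * r) ^ 2 ≤ (c + 2 * d) ^ 2 := by
    have : d * r ≤ d := mul_le_of_le_one_right hd hz
    refine pow_le_pow_left₀ (by positivity) (by linarith) 2
  -- From d c ≤ c² = 1 - d² one gets (c+2d)² = 1 + 3d² + 4cd ≤ 5 - d², a contradiction. Equality at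
  -- d = c shows why the factor is √5.
  nlinarith [mul_le_mul_of_nonneg_right hdc hc0.le]

end Chordal

/-! ### Matching eigenvalues along a path of pencils. -/

section Homotopy

variable {K : ℕ}

open Classical in
theorem exists_perm_chord_le {T : Type*} [TopologicalSpace T] [PreconnectedSpace T]
    {A B : T → Matrix (Fin K) (Fin K) ℂ} (hA : Continuous A) (hB : Continuous B)
    (hdet : ∀ t, (A t).det ≠ 0) {z : Fin K → ℂ} (hz : ∀ k, ‖z k‖ ≤ 1) {β : ℝ} (hβ : 0 ≤ β)
    (hβ' : β ≤ 1 / 2) (hclose : ∀ t w, (B t - w • A t).det = 0 → ∃ k, chord (z k) w ≤ β)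
    {t₀ t₁ : T} (h₀ : ∀ x, (B t₀ - x • A t₀).det = (-A t₀).det * ∏ k, (x - z k))
    {w : Fin K → ℂ} (hw : Finset.univ.val.map w = (pencilPoly (A t₁) (B t₁)).roots) :
    ∃ π : Equiv.Perm (Fin K), ∀ k, chord (z k) (w (π k)) ≤ (2 * K - 1) * β := by
  choose r hr hprod using fun t => exists_roots_pencilPoly (hdet t) (B t)
  have hrclose : ∀ t i, ∃ k, chord (z k) (r t i) ≤ β := fun t i => by
    refine hclose t _ ?_
    rw [hprod t, Finset.prod_eq_zero (Finset.mem_univ i) (sub_self _), mul_zero]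
  have hr₀ : Finset.univ.val.map (r t₀) = Finset.univ.val.map z :=
    map_eq_of_prod_sub_eq fun x =>
      mul_left_cancel₀ (det_neg_ne_zero (hdet t₀)) ((hprod t₀ x).symm.trans (h₀ x))
  have hr₁ : Finset.univ.val.map (r t₁) = Finset.univ.val.map w := (hr t₁).trans hw.symm
  have hwclose : ∀ j, ∃ k, chord (z k) (w j) ≤ β := fun j => by
    have hmem : w j ∈ Finset.univ.val.map (r t₁) := by
      rw [hr₁]
      exact Multiset.mem_map_of_mem w (Finset.mem_univ j)
    obtain ⟨i, -, hi⟩ := Multiset.mem_map.1 hmem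
    rw [← hi]
    exact hrclose t₁ i
  refine exists_perm_of_cluster_card chord_self chord_comm (fun x y v => chord_triangle x y v) hβ
    hwclose fun C hC => ?_
  have hcompact : ∀ S : Set (Fin K), IsCompact {x | ∃ k ∈ S, chord (z k) x ≤ β} := fun S => by
    have : {x | ∃ k ∈ S, chord (z k) x ≤ β} = ⋃ k ∈ S, {x | chord (z k) x ≤ β} := by
      ext x
      simp
    rw [this]
    exact S.toFinite.isCompact_biUnion fun k _ => isCompact_chord_le (hz k) hβ'
  have hdisj : Disjoint {x | ∃ k ∈ C, chord (z k) x ≤ β} {x | ∃ k ∈ Cᶜ, chord (z k) x ≤ β} := by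
    refine Set.disjoint_left.2 ?_
    rintro x ⟨k, hk, hkx⟩ ⟨l, hl, hlx⟩
    have := chord_triangle (z k) x (z l)
    rw [chord_comm x] at this
    linarith [hC k hk l hl]
  have hcov : ∀ t i, r t i ∈ {x | ∃ k ∈ C, chord (z k) x ≤ β} ∪
      {x | ∃ k ∈ Cᶜ, chord (z k) x ≤ β} := fun t i => by
    obtain ⟨k, hk⟩ := hrclose t i
    by_cases hkC : k ∈ C
    · exact Or.inl ⟨k, hkC, hk⟩
    · exact Or.inr ⟨k, hkC, hk⟩
  have hconst := card_roots_mem_const (fun x => (hB.sub (hA.const_smul x)).matrix_det)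
    hA.neg.matrix_det (fun t => det_neg_ne_zero (hdet t)) hprod (hcompact C) (hcompact Cᶜ)
    hdisj hcov t₁ t₀
  rw [card_filter_eq_of_map_eq hr₁, card_filter_eq_of_map_eq hr₀] at hconst
  refine Eq.trans ?_ (hconst.trans ?_)
  · congr
  · congr 1
    ext k
    simp only [Finset.mem_filter, Finset.mem_univ, true_and]
    refine ⟨fun ⟨l, hl, hlk⟩ => ?_, fun hk => ⟨k, hk, (chord_self _).trans_le hβ⟩⟩
    by_contra hk
    linarith [hC l hl k hk]

end Homotopy

/-! ### Perturbation of a compressed pencil. -/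

section Perturbation

variable {ι ι' : Type*} [Fintype ι] [Fintype ι'] {K : ℕ}

theorem euclNorm_compress_le {S : Matrix ι (Fin K) ℂ} {R : Matrix ι' (Fin K) ℂ}
    (hS : Sᴴ * S = 1) (hR : Rᴴ * R = 1) {G : Matrix ι ι' ℂ} {f : ℝ}
    (hG : ∀ v, euclNorm (G *ᵥ v) ≤ f * euclNorm v) (y : Fin K → ℂ) :
    euclNorm ((Sᴴ * G * R) *ᵥ y) ≤ f * euclNorm y := by
  rw [← Matrix.mulVec_mulVec, ← Matrix.mulVec_mulVec]
  have h1 := euclNorm_conjTranspose_mulVec_le zero_le_one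
    (fun v => by rw [euclNorm_mulVec_of_isometry hS, one_mul]) (G *ᵥ (R *ᵥ y))
  rw [one_mul] at h1
  refine h1.trans ((hG _).trans ?_)
  rw [euclNorm_mulVec_of_isometry hR]

theorem compress_pencil_eq (S : Matrix ι (Fin K) ℂ) (R : Matrix ι' (Fin K) ℂ)
    (B : Matrix ι (Fin K) ℂ) (F : Matrix (Fin K) ι' ℂ) (E₁ E₂ : Matrix ι ι' ℂ)
    (α z : Fin K → ℂ) (τ w : ℂ) :
    Sᴴ * (B * Matrix.diagonal (fun k => α k * z k) * F + τ • E₂) * R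
        - w • (Sᴴ * (B * Matrix.diagonal α * F + τ • E₁) * R)
      = (Sᴴ * B) * Matrix.diagonal (fun k => α k * (z k - w)) * (F * R)
        + Sᴴ * (τ • (E₂ - w • E₁)) * R := by
  have hd : Matrix.diagonal (fun k => α k * (z k - w))
      = Matrix.diagonal (fun k => α k * z k) - w • Matrix.diagonal α := by
    rw [← Matrix.diagonal_smul, Matrix.diagonal_sub]
    congr 1
    funext k
    simp only [Pi.smul_apply, smul_eq_mul]
    ring
  rw [hd]
  simp only [Matrix.mul_add, Matrix.add_mul, Matrix.mul_sub, Matrix.sub_mul, smul_add, smul_sub,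
    Matrix.mul_smul, Matrix.smul_mul, Matrix.mul_assoc]
  rw [smul_comm w τ]
  abel

theorem compress_first_eq (S : Matrix ι (Fin K) ℂ) (R : Matrix ι' (Fin K) ℂ)
    (B : Matrix ι (Fin K) ℂ) (F : Matrix (Fin K) ι' ℂ) (E₁ : Matrix ι ι' ℂ) (α : Fin K → ℂ)
    (τ : ℂ) : Sᴴ * (B * Matrix.diagonal α * F + τ • E₁) * R
      = (Sᴴ * B) * Matrix.diagonal α * (F * R) + Sᴴ * (τ • E₁) * R := by
  simp only [Matrix.mul_add, Matrix.add_mul, Matrix.mul_assoc]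

theorem one_add_le_sqrt_two_mul (r : ℝ) : 1 + r ≤ Real.sqrt 2 * Real.sqrt (1 + r ^ 2) := by
  rw [← Real.sqrt_mul zero_le_two]
  refine Real.le_sqrt_of_sq_le ?_
  nlinarith [sq_nonneg (1 - r)]

theorem euclNorm_smul_mulVec_le {E : Matrix ι ι' ℂ} {ε : ℝ}
    (hE : ∀ v, euclNorm (E *ᵥ v) ≤ ε * euclNorm v) {τ : ℂ} (hτ : ‖τ‖ ≤ 1) (v : ι' → ℂ) :
    euclNorm ((τ • E) *ᵥ v) ≤ ε * euclNorm v := by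
  rw [Matrix.smul_mulVec, euclNorm_smul]
  have h1 := mul_le_mul_of_nonneg_right hτ (euclNorm_nonneg (E *ᵥ v))
  linarith [hE v]

/-- The factor √(1+|w|²) is the one in the denominator of the chordal distance, so a bound uniform
in w results. -/
theorem euclNorm_pencil_mulVec_le {E₁ E₂ : Matrix ι ι' ℂ} {ε : ℝ} (hε : 0 ≤ ε)
    (hE₁ : ∀ v, euclNorm (E₁ *ᵥ v) ≤ ε * euclNorm v)
    (hE₂ : ∀ v, euclNorm (E₂ *ᵥ v) ≤ ε * euclNorm v) (w : ℂ) (v : ι' → ℂ) :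
    euclNorm ((E₂ - w • E₁) *ᵥ v)
      ≤ Real.sqrt 2 * ε * Real.sqrt (1 + ‖w‖ ^ 2) * euclNorm v := by
  have h1 : euclNorm ((E₂ - w • E₁) *ᵥ v) ≤ euclNorm (E₂ *ᵥ v) + ‖w‖ * euclNorm (E₁ *ᵥ v) := by
    rw [Matrix.sub_mulVec, sub_eq_add_neg, Matrix.smul_mulVec]
    refine (euclNorm_add_le _ _).trans ?_
    rw [euclNorm_neg, euclNorm_smul]
  have h2 := mul_le_mul_of_nonneg_left (hE₁ v) (norm_nonneg w)
  have h3 := mul_le_mul_of_nonneg_right (one_add_le_sqrt_two_mul ‖w‖)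
    (mul_nonneg hε (euclNorm_nonneg v))
  linarith [hE₂ v]

/-- Perturbation theorem for the generalized eigenvalues of a compressed pencil. -/
theorem exists_perm_chord_le_of_compress {S B : Matrix ι (Fin K) ℂ} {R : Matrix ι' (Fin K) ℂ}
    {F : Matrix (Fin K) ι' ℂ} {E₁ E₂ : Matrix ι ι' ℂ} {α z : Fin K → ℂ} {p q a A ε : ℝ}
    (hS : Sᴴ * S = 1) (hR : Rᴴ * R = 1) (hp : 0 < p) (hq : 0 < q) (ha : 0 < a) (hε : 0 ≤ ε)
    (hA : 0 ≤ A)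
    (hP : ∀ u, p * euclNorm u ≤ euclNorm ((Sᴴ * B) *ᵥ u))
    (hQ : ∀ u, q * euclNorm u ≤ euclNorm ((F * R) *ᵥ u)) (hα : ∀ k, a ≤ ‖α k‖)
    (hz : ∀ k, ‖z k‖ ≤ 1) (hAz : ∀ k, A ≤ ‖z k‖)
    (hE₁ : ∀ v, euclNorm (E₁ *ᵥ v) ≤ ε * euclNorm v)
    (hE₂ : ∀ v, euclNorm (E₂ *ᵥ v) ≤ ε * euclNorm v) (hεν : ε < p * q * a) {β : ℝ}
    (hβ : Real.sqrt 2 * (ε / (p * q * a)) / Real.sqrt (1 + A ^ 2) ≤ β) (hβ' : β ≤ 1 / 2) :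
    (Sᴴ * (B * Matrix.diagonal α * F + E₁) * R).det ≠ 0 ∧
    ∀ w : Fin K → ℂ, Finset.univ.val.map w
        = (pencilPoly (Sᴴ * (B * Matrix.diagonal α * F + E₁) * R)
          (Sᴴ * (B * Matrix.diagonal (fun k => α k * z k) * F + E₂) * R)).roots →
      ∃ π : Equiv.Perm (Fin K), ∀ k, chord (z k) (w (π k)) ≤ (2 * K - 1) * β := by
  have hν : 0 < p * q * a := by positivity
  have hβ0 : 0 ≤ β := le_trans (by positivity) hβ
  have hdet : ∀ τ : ℂ, ‖τ‖ ≤ 1 →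
      (Sᴴ * (B * Matrix.diagonal α * F + τ • E₁) * R).det ≠ 0 := by
    intro τ hτ h0
    rw [compress_first_eq] at h0
    obtain ⟨k, hk⟩ := exists_mul_norm_le_of_det_eq_zero hp.le hP hQ
      (euclNorm_compress_le hS hR (euclNorm_smul_mulVec_le hE₁ hτ)) h0
    have := mul_le_mul_of_nonneg_left (hα k) (mul_pos hp hq).le
    linarith
  have hclose : ∀ τ : ℂ, ‖τ‖ ≤ 1 → ∀ w,
      (Sᴴ * (B * Matrix.diagonal (fun k => α k * z k) * F + τ • E₂) * R
        - w • (Sᴴ * (B * Matrix.diagonal α * F + τ • E₁) * R)).det = 0 →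
      ∃ k, chord (z k) w ≤ β := by
    intro τ hτ w h0
    rw [compress_pencil_eq] at h0
    obtain ⟨k, hk⟩ := exists_mul_norm_le_of_det_eq_zero hp.le hP hQ
      (euclNorm_compress_le hS hR (euclNorm_smul_mulVec_le
        (euclNorm_pencil_mulVec_le hε hE₁ hE₂ w) hτ)) h0
    refine ⟨k, le_trans ?_ hβ⟩
    rw [norm_mul] at hk
    have hw := sqrt_one_add_sq_pos w
    have h1 : ‖z k - w‖ ≤ Real.sqrt 2 * (ε / (p * q * a)) * Real.sqrt (1 + ‖w‖ ^ 2) := by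
      have h2 : p * q * a * ‖z k - w‖ ≤ Real.sqrt 2 * ε * Real.sqrt (1 + ‖w‖ ^ 2) := by
        refine le_trans ?_ hk
        have := mul_le_mul_of_nonneg_right (hα k) (norm_nonneg (z k - w))
        have := mul_le_mul_of_nonneg_left this (mul_pos hp hq).le
        linarith
      rw [mul_div_assoc', div_mul_eq_mul_div, le_div_iff₀ hν]
      linarith
    have hA1 : 0 < Real.sqrt (1 + A ^ 2) := Real.sqrt_pos.2 (by positivity)
    have h3 : Real.sqrt (1 + A ^ 2) ≤ Real.sqrt (1 + ‖z k‖ ^ 2) := by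
      have := hAz k
      gcongr
    rw [chord, mul_comm (Real.sqrt _), ← div_div]
    refine div_le_div₀ (by positivity) ?_ hA1 h3
    rwa [div_le_iff₀ hw]
  have hunit : ∀ t : unitInterval, ‖((t : ℝ) : ℂ)‖ ≤ 1 := fun t => by
    rw [Complex.norm_real, Real.norm_of_nonneg t.2.1]
    exact t.2.2
  have hcont : ∀ X E : Matrix ι ι' ℂ,
      Continuous fun t : unitInterval => Sᴴ * (X + ((t : ℝ) : ℂ) • E) * R := fun X E => by
    have : Continuous fun t : unitInterval => ((t : ℝ) : ℂ) :=
      Complex.continuous_ofReal.comp continuous_subtype_val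
    exact (continuous_const.matrix_mul
      (continuous_const.add (this.smul continuous_const))).matrix_mul continuous_const
  have h1 : (((1 : unitInterval) : ℝ) : ℂ) = 1 := by simp
  have h0 : (((0 : unitInterval) : ℝ) : ℂ) = 0 := by simp
  refine ⟨by simpa using hdet 1 (by simp), fun w hw => ?_⟩
  -- Only the noise blocks move. S and R stay those of the fully noisy matrix, so P and Q, and with
  -- them the lower bounds, do not depend on t.
  refine exists_perm_chord_le (t₀ := (0 : unitInterval)) (t₁ := 1) (hcont _ E₁) (hcont _ E₂)
    (fun t => hdet _ (hunit t)) hz hβ0 hβ' (fun t => hclose _ (hunit t)) (fun x => ?_) ?_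
  · rw [compress_pencil_eq, compress_first_eq, h0]
    simp only [zero_smul, Matrix.mul_zero, Matrix.zero_mul, add_zero]
    rw [Matrix.det_neg]
    simp only [Matrix.det_mul, Matrix.det_diagonal, Finset.prod_mul_distrib]
    have : ∏ k, (z k - x) = (-1) ^ Fintype.card (Fin K) * ∏ k, (x - z k) := by
      rw [← Finset.card_univ, ← Finset.prod_const, ← Finset.prod_mul_distrib]
      exact Finset.prod_congr rfl fun k _ => by ring
    rw [this]
    ring
  · rw [h1, one_smul, one_smul]
    exact hw

end Perturbation

/-! ### Hankel matrices and their Vandermonde factorisation. -/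

section DataMatrices

theorem sum_norm_sq_comp_le {N b : ℕ} (e : Fin N → ℂ) {f : Fin b → Fin N}
    (hf : Function.Injective f) : ∑ j, ‖e (f j)‖ ^ 2 ≤ euclNorm e ^ 2 := by
  rw [euclNorm_sq, ← Finset.sum_image (s := Finset.univ) (g := f) (f := fun i => ‖e i‖ ^ 2)
    (fun _ _ _ _ h => hf h)]
  exact Finset.sum_le_sum_of_subset_of_nonneg (Finset.subset_univ _) fun _ _ _ => by positivity

/-- A matrix whose rows and columns are made of distinct entries of `e`. -/
theorem euclNorm_mulVec_le_of_entries {N a b : ℕ} (e : Fin N → ℂ) {f : Fin a → Fin b → Fin N}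
    (hrow : ∀ i, Function.Injective (f i)) (hcol : ∀ j, Function.Injective fun i => f i j)
    (v : Fin b → ℂ) :
    euclNorm ((Matrix.of fun i j => e (f i j)) *ᵥ v)
      ≤ Real.sqrt ((min a b : ℕ) : ℝ) * euclNorm e * euclNorm v := by
  refine (pow_le_pow_iff_left₀ (euclNorm_nonneg _) (mul_nonneg (mul_nonneg (Real.sqrt_nonneg _)
    (euclNorm_nonneg _)) (euclNorm_nonneg _)) two_ne_zero).1 ?_
  refine (euclNorm_sq_mulVec_le _ v).trans ?_
  rw [mul_pow, mul_pow, Real.sq_sqrt (Nat.cast_nonneg _)]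
  refine mul_le_mul_of_nonneg_right ?_ (sq_nonneg _)
  simp only [Matrix.of_apply]
  -- The squared Frobenius norm can be summed by rows or by columns, each contributing at most ‖e‖².
  -- The better choice gives the minimum.
  have h1 : ∑ i, ∑ j, ‖e (f i j)‖ ^ 2 ≤ a * euclNorm e ^ 2 := by
    have := Finset.sum_le_sum fun i (_ : i ∈ Finset.univ) => sum_norm_sq_comp_le e (hrow i)
    simpa using this
  have h2 : ∑ i, ∑ j, ‖e (f i j)‖ ^ 2 ≤ b * euclNorm e ^ 2 := by
    rw [Finset.sum_comm]
    have := Finset.sum_le_sum fun j (_ : j ∈ Finset.univ) => sum_norm_sq_comp_le e (hcol j)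
    simpa using this
  rcases min_choice a b with h | h <;> rw [h] <;> assumption

variable {N K L : ℕ}

theorem euclNorm_dataMat₁_mulVec_le (h : L < N) (e : Fin N → ℂ) (v : Fin (N - L) → ℂ) :
    euclNorm (dataMat₁ L h e *ᵥ v)
      ≤ Real.sqrt ((min L (N - L) : ℕ) : ℝ) * euclNorm e * euclNorm v :=
  euclNorm_mulVec_le_of_entries e (f := fun i j => ⟨(i : ℕ) + (j : ℕ), by omega⟩)
    (fun i j j' hj => Fin.ext (by simpa using hj)) (fun j i i' hi => Fin.ext (by simpa using hi)) v

theorem euclNorm_dataMat₂_mulVec_le (h : L < N) (e : Fin N → ℂ) (v : Fin (N - L) → ℂ) :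
    euclNorm (dataMat₂ L h e *ᵥ v)
      ≤ Real.sqrt ((min L (N - L) : ℕ) : ℝ) * euclNorm e * euclNorm v :=
  euclNorm_mulVec_le_of_entries e (f := fun i j => ⟨(i : ℕ) + (j : ℕ) + 1, by omega⟩)
    (fun i j j' hj => Fin.ext (by simpa using hj)) (fun j i i' hi => Fin.ext (by simpa using hi)) v

theorem vandermonde_factorization (z β : Fin K → ℂ) (L M : ℕ) (i : Fin L) (j : Fin M) :
    (vanderMat L z * Matrix.diagonal β * (vanderMat M z)ᵀ) i j
      = ∑ k, β k * z k ^ ((i : ℕ) + (j : ℕ)) := by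
  rw [Matrix.mul_apply]
  refine Finset.sum_congr rfl fun k _ => ?_
  rw [Matrix.mul_diagonal, Matrix.transpose_apply]
  simp only [vanderMat, Matrix.of_apply]
  ring

theorem dataMat₁_eq (h : L < N) {z α : Fin K → ℂ} {e x : Fin N → ℂ}
    (hx : ∀ n, x n = cisoidSum N α z n + e n) :
    dataMat₁ L h x = vanderMat L z * Matrix.diagonal α * (vanderMat (N - L) z)ᵀ
      + dataMat₁ L h e := by
  ext i j
  rw [Matrix.add_apply, vandermonde_factorization]
  simp only [dataMat₁, hankel, Matrix.of_apply, hx, cisoidSum]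

theorem dataMat₂_eq (h : L < N) {z α : Fin K → ℂ} {e x : Fin N → ℂ}
    (hx : ∀ n, x n = cisoidSum N α z n + e n) :
    dataMat₂ L h x
      = vanderMat L z * Matrix.diagonal (fun k => α k * z k) * (vanderMat (N - L) z)ᵀ
      + dataMat₂ L h e := by
  ext i j
  rw [Matrix.add_apply, vandermonde_factorization]
  simp only [dataMat₂, hankel, Matrix.of_apply, hx, cisoidSum, pow_succ]
  congr 1
  exact Finset.sum_congr rfl fun k _ => by ring

/-- Conjugation preserves norms. This lets Vᵀ be written as Cᴴ with C the conjugate of V. -/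
theorem conj_lower_bound {ι κ : Type*} [Fintype ι] [Fintype κ] {V : Matrix ι κ ℂ} {c : ℝ}
    (hV : ∀ u, c * euclNorm u ≤ euclNorm (V *ᵥ u)) (u : κ → ℂ) :
    c * euclNorm u ≤ euclNorm ((Vᵀ)ᴴ *ᵥ u) := by
  have h : (Vᵀ)ᴴ *ᵥ u = star (V *ᵥ star u) := by
    rw [Matrix.star_mulVec, star_star, ← Matrix.mulVec_transpose]
    rfl
  rw [h, euclNorm_star, ← euclNorm_star u]
  exact hV _

end DataMatrices

/-! ### Constants and assembly. -/

/-- Keeping only the term with 2√2/(1-γ), and using A ≤ 1 and n ≥ 1, gives 2γ/(1-γ) ≤ d < 1/√2, so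
(γ/(1-γ))² ≤ 1/8. Then 1/(1-s²) ≤ 8/7 for s = γ/(1-γ), the source of the factor 8/7. The last bound
reduces to 5 (8√2/7)² ≤ (2√2+1)². -/
theorem chordalBound_estimates {n γ A Q d : ℝ} (hn : 1 ≤ n) (hγ0 : 0 ≤ γ) (hγ1 : γ < 1)
    (hA0 : 0 ≤ A) (hA1 : A ≤ 1) (hQ : 1 ≤ Q)
    (hd : d = n * γ / Real.sqrt (1 + A ^ 2) * (2 * Real.sqrt 2 / (1 - γ) * Q
      + (1 + Real.sqrt 2 * γ / (1 - γ)))) (hd1 : d < 1 / Real.sqrt 2) :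
    0 ≤ d ∧ d ^ 2 < 1 / 2 ∧ (γ / (1 - γ)) ^ 2 ≤ 1 / 8 ∧
      5 * (n * (Real.sqrt 2 * (8 / 7 * γ) / Real.sqrt (1 + A ^ 2))) ^ 2 ≤ d ^ 2 := by
  have h2 : Real.sqrt 2 ^ 2 = 2 := Real.sq_sqrt zero_le_two
  have h2' : 0 < Real.sqrt 2 := Real.sqrt_pos.2 two_pos
  have h2'' : 5 / 4 ≤ Real.sqrt 2 := by
    rw [Real.le_sqrt' (by norm_num)]
    norm_num
  have hA : 0 < Real.sqrt (1 + A ^ 2) := Real.sqrt_pos.2 (by positivity)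
  have hA' : Real.sqrt (1 + A ^ 2) ≤ Real.sqrt 2 := Real.sqrt_le_sqrt (by nlinarith)
  have hg : 0 < 1 - γ := by linarith
  set g := n * γ / Real.sqrt (1 + A ^ 2) with hgdef
  have hg0 : 0 ≤ g := by positivity
  have hlow : γ / Real.sqrt 2 ≤ g := by
    rw [hgdef]
    have : γ ≤ n * γ := le_mul_of_one_le_left hγ0 hn
    gcongr
  have hb1 : 2 * Real.sqrt 2 / (1 - γ) ≤ 2 * Real.sqrt 2 / (1 - γ) * Q :=
    le_mul_of_one_le_right (by positivity) hQ
  have hb2 : 0 ≤ Real.sqrt 2 * γ / (1 - γ) := by positivity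
  have hb3 : 2 * Real.sqrt 2 ≤ 2 * Real.sqrt 2 / (1 - γ) := by
    rw [le_div_iff₀ hg]
    nlinarith
  have hd0 : 0 ≤ d := by
    rw [hd]
    positivity
  have hd2 : d ^ 2 < 1 / 2 := by
    have := pow_lt_pow_left₀ hd1 hd0 two_ne_zero
    rwa [div_pow, h2, one_pow] at this
  have hds : 2 * (γ / (1 - γ)) ≤ d := by
    calc 2 * (γ / (1 - γ)) = γ / Real.sqrt 2 * (2 * Real.sqrt 2 / (1 - γ)) := by field_simp
      _ ≤ g * (2 * Real.sqrt 2 / (1 - γ)) := by gcongr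
      _ ≤ d := by
        rw [hd]
        refine mul_le_mul_of_nonneg_left ?_ hg0
        linarith
  refine ⟨hd0, hd2, ?_, ?_⟩
  · have : 0 ≤ γ / (1 - γ) := by positivity
    nlinarith
  · have e1 : n * (Real.sqrt 2 * (8 / 7 * γ) / Real.sqrt (1 + A ^ 2))
        = g * (8 / 7 * Real.sqrt 2) := by
      rw [hgdef]
      ring
    have e2 : g * (2 * Real.sqrt 2 + 1) ≤ d := by
      rw [hd]
      refine mul_le_mul_of_nonneg_left ?_ hg0
      linarith
    have e3 := pow_le_pow_left₀ (by positivity) e2 2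
    rw [e1]
    refine le_trans ?_ e3
    have e4 : 5 * (8 / 7 * Real.sqrt 2) ^ 2 ≤ (2 * Real.sqrt 2 + 1) ^ 2 := by nlinarith
    calc 5 * (g * (8 / 7 * Real.sqrt 2)) ^ 2 = g ^ 2 * (5 * (8 / 7 * Real.sqrt 2) ^ 2) := by ring
      _ ≤ g ^ 2 * (2 * Real.sqrt 2 + 1) ^ 2 := by gcongr
      _ = _ := by ring

/-- The compressed pencil of `X = B * diagonal α * Cᴴ + E` is bounded below through the factors
`B` and `Cᴴ`, as long as the noise `E` is small. -/
theorem compress_lower_bounds {m n K : ℕ} {A E : Matrix (Fin m) (Fin n) ℂ} (D : SVD A K)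
    (hm : K ≤ m) (hn : K ≤ n) {B : Matrix (Fin m) (Fin K) ℂ} {C : Matrix (Fin n) (Fin K) ℂ}
    {α : Fin K → ℂ} (hA : A = B * Matrix.diagonal α * Cᴴ + E) {σ₁ σ₂ a ε : ℝ} (hσ₁ : 0 < σ₁)
    (hσ₂ : 0 < σ₂) (ha : 0 < a) (hε : 0 ≤ ε) (hB : ∀ u, σ₁ * euclNorm u ≤ euclNorm (B *ᵥ u))
    (hC : ∀ u, σ₂ * euclNorm u ≤ euclNorm (C *ᵥ u)) (hα : ∀ k, a ≤ ‖α k‖)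
    (hE : ∀ v, euclNorm (E *ᵥ v) ≤ ε * euclNorm v) (hεμ : ε < a * σ₁ * σ₂)
    (hs : (ε / (a * σ₁ * σ₂ - ε)) ^ 2 < 1) :
    (∀ u, σ₁ * Real.sqrt (1 - (ε / (a * σ₁ * σ₂ - ε)) ^ 2) * euclNorm u
      ≤ euclNorm (((D.left hm)ᴴ * B) *ᵥ u)) ∧
    ∀ u, σ₂ * Real.sqrt (1 - (ε / (a * σ₁ * σ₂ - ε)) ^ 2) * euclNorm u
      ≤ euclNorm ((Cᴴ * D.right hn) *ᵥ u) := by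
  have hμ : 0 < a * σ₁ * σ₂ - ε := sub_pos.2 hεμ
  have hlow : ∀ u, (a * σ₁ * σ₂ - ε) * euclNorm (C *ᵥ u) ≤ euclNorm (A *ᵥ (C *ᵥ u)) := by
    intro u
    have h1 := lower_bound_conjTranspose_on_range hσ₂ hC u
    have h2 := euclNorm_diagonal_mulVec_ge ha.le hα (Cᴴ *ᵥ (C *ᵥ u))
    have h3 := hB (Matrix.diagonal α *ᵥ (Cᴴ *ᵥ (C *ᵥ u)))
    have h4 : B *ᵥ (Matrix.diagonal α *ᵥ (Cᴴ *ᵥ (C *ᵥ u)))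
        = A *ᵥ (C *ᵥ u) + -(E *ᵥ (C *ᵥ u)) := by
      rw [hA, Matrix.add_mulVec, add_neg_cancel_right]
      simp only [Matrix.mulVec_mulVec, Matrix.mul_assoc]
    rw [h4] at h3
    have h5 := h3.trans (euclNorm_add_le _ _)
    rw [euclNorm_neg] at h5
    have h6 := mul_le_mul_of_nonneg_left h2 hσ₁.le
    have h7 := mul_le_mul_of_nonneg_left h1 (mul_pos hσ₁ ha).le
    linarith [hE (C *ᵥ u)]
  have hCinj : Function.Injective (C *ᵥ ·) := by
    intro u v huv
    by_contra hne
    have h0 : C *ᵥ (u - v) = 0 := by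
      rw [Matrix.mulVec_sub, sub_eq_zero]
      exact huv
    have h1 := hC (u - v)
    rw [h0, euclNorm_zero] at h1
    exact absurd h1 (not_le.2 (mul_pos hσ₂ (euclNorm_pos (sub_ne_zero.2 hne))))
  have hsv := D.le_singularValue hm hn hCinj hlow
  have hSB := exists_near_range (B := B) (F := Matrix.diagonal α * Cᴴ) (D.left_isometry hm)
    (D.right_isometry hn) (D.mul_right hm hn) (by rw [← Matrix.mul_assoc]; exact hA) hE hε hμ hsv
  -- Right singular vectors of A are left singular vectors of Aᴴ.
  have hRC := exists_near_range (B := C) (F := (Matrix.diagonal α)ᴴ * Bᴴ) (D.right_isometry hn)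
    (D.left_isometry hm) (D.conjTranspose_mul_left hm hn) (E := Eᴴ)
    (by
      refine (congrArg Matrix.conjTranspose hA).trans ?_
      simp only [Matrix.conjTranspose_add, Matrix.conjTranspose_mul,
        Matrix.conjTranspose_conjTranspose])
    (euclNorm_conjTranspose_mulVec_le hε hE) hε hμ hsv
  -- The projection argument bounds BᴴS. Being square, it passes its lower bound on to its adjoint
  -- SᴴB.
  refine ⟨lower_bound_of_conjTranspose (mul_pos hσ₁ (Real.sqrt_pos.2 (sub_pos.2 hs))) ?_,
    lower_bound_conjTranspose_mul (D.right_isometry hn) hσ₂ hC hRC⟩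
  rw [Matrix.conjTranspose_mul, Matrix.conjTranspose_conjTranspose]
  exact lower_bound_conjTranspose_mul (D.left_isometry hm) hσ₁ hB hSB

theorem genEigenvalues_of_det_ne_zero {K : ℕ} {A : Matrix (Fin K) (Fin K) ℂ} (hA : A.det ≠ 0)
    (B : Matrix (Fin K) (Fin K) ℂ) :
    genEigenvalues A B = (pencilPoly A B).roots.map (OnePoint.some : ℂ → OnePoint ℂ) := by
  rw [genEigenvalues, pencilPoly_natDegree hA, Nat.sub_self, Multiset.replicate_zero, add_zero,
    Multiset.map_id']
  exact Multiset.bind_singleton _ _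

/-- The compressed pencil of the matrix pencil method has only finite generalized eigenvalues, and
these can be matched with the nodes. -/
theorem compress_dataMat_eigenvalues_close {N K L : ℕ} (hK : 1 ≤ K) (hL : L < N) (hKL : K ≤ L)
    (hKM : K ≤ N - L) (z α : Fin K → ℂ) (hz_le : ∀ k, ‖z k‖ ≤ 1)
    (hz_inj : Function.Injective z) (hα : ∀ k, α k ≠ 0)
    (e : EuclideanSpace ℂ (Fin N)) (x : Fin N → ℂ) (hx : ∀ n, x n = cisoidSum N α z n + e n)
    (D : SVD (dataMat₁ L hL x) K) (hγ : mpGamma L z α e < 1)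
    (hd : mpChordalBound L z α e < 1 / Real.sqrt 2) :
    (D.compress hKL hKM (dataMat₁ L hL x)).det ≠ 0 ∧
    ∀ w : Fin K → ℂ, Finset.univ.val.map w
        = (pencilPoly (D.compress hKL hKM (dataMat₁ L hL x))
          (D.compress hKL hKM (dataMat₂ L hL x))).roots →
      ∃ π : Equiv.Perm (Fin K), ∀ k, ‖z k - w (π k)‖ ≤ mpEta (mpChordalBound L z α e) ‖z k‖ := by
  have : Nonempty (Fin K) := ⟨⟨0, hK⟩⟩
  set σ₁ := sigmaMin (vanderMat L z) with hσ₁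
  set σ₂ := sigmaMin (vanderMat (N - L) z) with hσ₂
  have hσ₁0 : 0 < σ₁ := sigmaMin_pos hK hKL (vanderMat_mulVec_injective hKL hz_inj)
  have hσ₂0 : 0 < σ₂ := sigmaMin_pos hK hKM (vanderMat_mulVec_injective hKM hz_inj)
  set a := ⨅ k, ‖α k‖ with ha
  have haα : ∀ k, a ≤ ‖α k‖ := fun k => ciInf_le (Finite.bddBelow_range _) k
  have ha0 : 0 < a := by
    obtain ⟨k, hk⟩ := exists_eq_ciInf_of_finite (f := fun k => ‖α k‖)
    rw [ha, ← hk]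
    exact norm_pos_iff.2 (hα k)
  have haA : 1 ≤ (⨆ k, ‖α k‖) / a := by
    rw [one_le_div ha0]
    exact (haα (Classical.arbitrary _)).trans (le_ciSup (f := fun k => ‖α k‖) (Finite.bddAbove_range _) _)
  set A := ⨅ k, ‖z k‖ with hA
  have hAz : ∀ k, A ≤ ‖z k‖ := fun k => ciInf_le (Finite.bddBelow_range _) k
  have hA0 : 0 ≤ A := Real.iInf_nonneg fun k => norm_nonneg _
  have hA1 : A ≤ 1 := (hAz (Classical.arbitrary _)).trans (hz_le _)
  set ε := Real.sqrt ((min L (N - L) : ℕ) : ℝ) * euclNorm e.ofLp with hε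
  have hε0 : 0 ≤ ε := mul_nonneg (Real.sqrt_nonneg _) (euclNorm_nonneg _)
  set μ := a * σ₁ * σ₂ with hμ
  have hμ0 : 0 < μ := by positivity
  set γ := mpGamma L z α e with hγdef
  have hγε : ε = γ * μ := by
    have : γ = ε / μ := rfl
    rw [this, div_mul_cancel₀ _ hμ0.ne']
  have hγ0 : 0 ≤ γ := by
    by_contra h
    nlinarith
  set d := mpChordalBound L z α e with hddef
  have hn : (1 : ℝ) ≤ 2 * K - 1 := by
    have : (1 : ℝ) ≤ K := by exact_mod_cast hK
    linarith
  have hQ : 1 ≤ (⨆ k, ‖α k‖) / a * condNumber (vanderMat L z)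
      * condNumber (vanderMat (N - L) z) :=
    one_le_mul_of_one_le_of_one_le (one_le_mul_of_one_le_of_one_le haA (one_le_condNumber hσ₁0))
      (one_le_condNumber hσ₂0)
  obtain ⟨hd0, hd2, hs, hβd⟩ := chordalBound_estimates (d := d) hn hγ0 hγ hA0 hA1 hQ
    (by
      rw [hddef, mpChordalBound, ← hγdef]
      ring) hd
  have hγ1 : 0 < 1 - γ := by linarith
  have hseq : ε / (μ - ε) = γ / (1 - γ) := by
    rw [hγε, show μ - γ * μ = (1 - γ) * μ by ring, mul_div_mul_right _ _ hμ0.ne']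
  have hγs : γ ≤ γ / (1 - γ) := by
    rw [le_div_iff₀ hγ1]
    nlinarith
  set t := Real.sqrt (1 - (γ / (1 - γ)) ^ 2) with ht
  have ht2 : t ^ 2 = 1 - (γ / (1 - γ)) ^ 2 := Real.sq_sqrt (by linarith)
  have ht0 : 0 < t := Real.sqrt_pos.2 (by linarith)
  have hX₁ := dataMat₁_eq hL hx
  have hX₂ := dataMat₂_eq hL hx
  have hE₁ := euclNorm_dataMat₁_mulVec_le hL e.ofLp
  have hE₂ := euclNorm_dataMat₂_mulVec_le hL e.ofLp
  have hB := sigmaMin_mul_euclNorm_le hKL (vanderMat L z)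
  have hC := conj_lower_bound (sigmaMin_mul_euclNorm_le hKM (vanderMat (N - L) z))
  have hγ78 : γ < 7 / 8 := by nlinarith
  obtain ⟨hP, hR⟩ := compress_lower_bounds D hKL hKM
    (C := ((vanderMat (N - L) z)ᵀ)ᴴ) (by rw [Matrix.conjTranspose_conjTranspose]; exact hX₁)
    hσ₁0 hσ₂0 ha0 hε0 hB hC haα hE₁ (by nlinarith) (by rw [hseq]; linarith)
  rw [Matrix.conjTranspose_conjTranspose] at hR
  rw [hseq] at hP hR
  set β := Real.sqrt 2 * (8 / 7 * γ) / Real.sqrt (1 + A ^ 2) with hβ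
  have hβ0 : 0 ≤ β := by positivity
  have hνμ : σ₁ * t * (σ₂ * t) * a = t ^ 2 * μ := by
    rw [hμ]
    ring
  have hεν : ε / (σ₁ * t * (σ₂ * t) * a) ≤ 8 / 7 * γ := by
    rw [hνμ, hγε, mul_div_mul_right _ _ hμ0.ne', div_le_iff₀ (by positivity), ht2]
    nlinarith
  have hβ2 : β ≤ 1 / 2 := by
    -- Here β² ≤ (nβ)² ≤ d²/5 < 1/10 with n = 2K-1, which keeps the chordal discs bounded.
    have h1 := pow_le_pow_left₀ hβ0 (le_mul_of_one_le_left hβ0 hn) 2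
    refine (pow_le_pow_iff_left₀ hβ0 (by norm_num) two_ne_zero).1 ?_
    linarith
  have hε' : ε < σ₁ * t * (σ₂ * t) * a := by
    rw [hνμ, hγε]
    refine mul_lt_mul_of_pos_right ?_ hμ0
    linarith
  have hβ' : Real.sqrt 2 * (ε / (σ₁ * t * (σ₂ * t) * a)) / Real.sqrt (1 + A ^ 2) ≤ β :=
    div_le_div_of_nonneg_right (mul_le_mul_of_nonneg_left hεν (Real.sqrt_nonneg _))
      (Real.sqrt_nonneg _)
  have hmain := exists_perm_chord_le_of_compress (D.left_isometry hKL)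
    (D.right_isometry hKM) (mul_pos hσ₁0 ht0) (mul_pos hσ₂0 ht0) ha0 hε0 hA0 hP hR haα hz_le hAz
    hE₁ hE₂ hε' hβ' hβ2
  have hΨ₁ : D.compress hKL hKM (dataMat₁ L hL x) = (D.left hKL)ᴴ * (vanderMat L z
      * Matrix.diagonal α * (vanderMat (N - L) z)ᵀ + dataMat₁ L hL e.ofLp) * D.right hKM :=
    congrArg (fun M => (D.left hKL)ᴴ * M * D.right hKM) hX₁
  have hΨ₂ : D.compress hKL hKM (dataMat₂ L hL x) = (D.left hKL)ᴴ * (vanderMat L z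
      * Matrix.diagonal (fun k => α k * z k) * (vanderMat (N - L) z)ᵀ + dataMat₂ L hL e.ofLp)
      * D.right hKM :=
    congrArg (fun M => (D.left hKL)ᴴ * M * D.right hKM) hX₂
  rw [hΨ₁, hΨ₂]
  refine ⟨hmain.1, fun w hw => ?_⟩
  obtain ⟨π, hπ⟩ := hmain.2 w hw
  exact ⟨π, fun k => norm_sub_le_mpEta (hz_le k) hd0 hd2 hβd (hπ k)⟩

end CisoidMP

end

theorem corollary1 {N K L : ℕ} (hK : 1 ≤ K) (hN : 2 * K ≤ N) (hKL : K ≤ L) (hLN : L ≤ N - K)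
    (z α : Fin K → ℂ) (hz_le : ∀ k, ‖z k‖ ≤ 1) (hz_ne : ∀ k, z k ≠ 0)
    (hz_inj : Function.Injective z) (hα : ∀ k, α k ≠ 0)
    (e : EuclideanSpace ℂ (Fin N)) (x : Fin N → ℂ)
    (hx : ∀ n, x n = CisoidMP.cisoidSum N α z n + e n)
    (D : CisoidMP.SVD (CisoidMP.dataMat₁ L (by omega : L < N) x) K)
    (hreg : CisoidMP.IsRegularPair
      (D.compress hKL (by omega : K ≤ N - L) (CisoidMP.dataMat₁ L (by omega : L < N) x))
      (D.compress hKL (by omega : K ≤ N - L) (CisoidMP.dataMat₂ L (by omega : L < N) x)))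
    (hγ : CisoidMP.mpGamma L z α e < 1)
    (hd : CisoidMP.mpChordalBound L z α e < 1 / Real.sqrt 2)
    (zhat : Fin K → OnePoint ℂ)
    (hzhat : CisoidMP.IsMPEstimate (by omega : L < N) hKL (by omega : K ≤ N - L) x D zhat) :
    ∃ π : Equiv.Perm (Fin K), ∀ k, ∃ w : ℂ, zhat (π k) = (w : OnePoint ℂ) ∧
      ‖z k - w‖ ≤ CisoidMP.mpEta (CisoidMP.mpChordalBound L z α e) ‖z k‖ := by
  have hL : L < N := by omega
  have hKM : K ≤ N - L := by omega
  obtain ⟨hdet, hclose⟩ := CisoidMP.compress_dataMat_eigenvalues_close hK hL hKL hKM z α hz_le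
    hz_inj hα e x hx D hγ hd
  rw [CisoidMP.IsMPEstimate, CisoidMP.genEigenvalues_of_det_ne_zero hdet] at hzhat
  have hfin : ∀ k, ∃ w : ℂ, zhat k = (w : OnePoint ℂ) := fun k => by
    have hmem : zhat k ∈ Finset.univ.val.map zhat :=
      Multiset.mem_map_of_mem zhat (Finset.mem_univ k)
    rw [hzhat] at hmem
    obtain ⟨w, -, hw⟩ := Multiset.mem_map.1 hmem
    exact ⟨w, hw.symm⟩
  choose w hw using hfin
  have hroots : (Finset.univ.val.map w).map (OnePoint.some : ℂ → OnePoint ℂ)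
      = Finset.univ.val.map zhat := by
    rw [Multiset.map_map]
    exact Multiset.map_congr rfl fun k _ => (hw k).symm
  obtain ⟨π, hπ⟩ := hclose w (Multiset.map_injective OnePoint.coe_injective (hroots.trans hzhat))
  exact ⟨π, fun k => ⟨w (π k), hw (π k), hπ k⟩⟩
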